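/- Let $A=G\langle g\rangle$ be a finite group that is the product of a normal subgroup $G$ and a cyclic subgroup $\langle g\rangle$, and let $R$ be the soluble radical of $G$ (its largest soluble normal subgroup). Let $C_{\langle g\rangle}(G/R)$ be the subgroup of those elements of $\langle g\rangle$ that induce the trivial automorphism of $G/R$ by conjugation, and let $\bar g$ be the automorphism of $G/R$ induced by conjugation by $g$. Suppose that the following conditions hold: (1) $G$ is a minimal $g$-invariant subgroup covering $G/R$; that is, if $K\leq G$ is a subgroup with $K^g=K$ and $KR=G$, then $K=G$; (2) $G\cap\langle g\rangle\leq C_{\langle g\rangle}(G/R)$; (3) $G/R=S_1\times\dots\times S_r$ with $r\geq 1$ is a direct product of isomorphic nonabelian finite simple groups $S_i$, which are transitively permuted by $\bar g$; (4) for some prime $p$ the stabilizer of $S_1$ in $\langle\bar g\rangle$ is a $p$-group, possibly trivial. Then for every subgroup $H\leq G\langle g\rangle$ such that $G\not\leq H$ there is $z\in G$ such that $H^z\cap\langle g\rangle\leq C_{\langle g\rangle}(G/R)$, where $H^z=z^{-1}Hz$. -/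

import Mathlib

open scoped Pointwise

/-- The soluble radical of `G`: the subgroup generated by all soluble normal subgroups of `G`
(for finite `G` it is the largest soluble normal subgroup). -/
def solubleRadical (G : Type*) [Group G] : Subgroup G :=
  sSup {N : Subgroup G | N.Normal ∧ Group.IsSolvable N}

instance solubleRadical_characteristic (G : Type*) [Group G] :
    (solubleRadical G).Characteristic := by
  rw [Subgroup.characteristic_iff_map_le]
  intro φ
  rw [solubleRadical, (Subgroup.gc_map_comap φ.toMonoidHom).l_sSup]
  refine iSup₂_le fun N hN => le_sSup ⟨hN.1.map _ φ.surjective, ?_⟩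
  have := hN.2
  exact Group.isSolvable_of_surjective (φ.toMonoidHom.subgroupMap_surjective N)

/-- The automorphism of `G ⧸ N` induced by an automorphism of `G`, for `N` characteristic. -/
def quotientAut {G : Type*} [Group G] (N : Subgroup G) [N.Characteristic] :
    MulAut G →* MulAut (G ⧸ N) where
  toFun φ := QuotientGroup.congr N N φ (Subgroup.characteristic_iff_map_eq.mp ‹_› φ)
  map_one' := by
    ext x
    induction x using QuotientGroup.induction_on
    rfl
  map_mul' φ ψ := by
    ext x
    induction x using QuotientGroup.induction_on
    rfl

/-- The action of `A` by conjugation on `G/R`, where `G` is a normal subgroup of `A` and `R` is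
the soluble radical of `G`. -/
def conjModRadical {A : Type*} [Group A] (G : Subgroup A) [G.Normal] :
    A →* MulAut (G ⧸ solubleRadical G) :=
  (quotientAut (solubleRadical G)).comp MulAut.conjNormal

/-- The centralizer `C_{⟨g⟩}(G/R)`, where `R` is the soluble radical of `G`. -/
def centralizerModRadical {A : Type*} [Group A] (G : Subgroup A) [G.Normal] (g : A) :
    Subgroup A :=
  Subgroup.zpowers g ⊓ (conjModRadical G).ker

/-- `K ≤ G` is `g`-invariant: `gKg⁻¹ = K`. -/
def IsInvariantUnder {A : Type*} [Group A] (G : Subgroup A) [G.Normal] (g : A)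
    (K : Subgroup G) : Prop :=
  (MulAut.conjNormal g : MulAut G) • K = K

/-- `K ≤ G` covers `G/R`, where `R` is the soluble radical of `G`. -/
def CoversModRadical {G : Type*} [Group G] (K : Subgroup G) : Prop :=
  K.map (QuotientGroup.mk' (solubleRadical G)) = ⊤

/-- `Q` is the internal direct product of the family of subgroups `S`. -/
structure IsInternalDirectProduct {Q ι : Type*} [Group Q] (S : ι → Subgroup Q) : Prop where
  normal : ∀ i, (S i).Normal
  independent : iSupIndep S
  iSup_eq_top : ⨆ i, S i = ⊤

/-- `S` is a nonabelian simple group. -/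
def IsNonabelianSimple (S : Type*) [Group S] : Prop :=
  IsSimpleGroup S ∧ ∃ a b : S, a * b ≠ b * a

/-!
Put `C = C_{⟨g⟩}(G/R)`. Every element of `⟨g⟩` outside `C` has among its powers one of finitely
many `x i ∈ ⟨g⟩ \ C`, where `x i` has order a power of a prime `q i`, satisfies `x i ^ q i ∈ C`,
and the primes `q i` are distinct. So it suffices to find `z ∈ G` such that no `z (x i) z⁻¹` lies
in `H`.

Suppose that `G ≰ H R`. Then one may pass to `(G/R) ⋊ ⟨g⟩`. If every `x i` stabilizes `S₁`, then
`q i = p`, there is a single `x`, and its conjugates do not all lie in the image of `H` because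
`[G/R, x] = G/R`. If some `x = x i` moves `S₁`, then its fixed points in `G/R` form a smaller
product of simple groups, with diagonal factors, that satisfies the same hypotheses. If no good `z`
existed, induction would show that for every `z` either `z x z⁻¹` or the conjugate by `z` of these
fixed points lies in the image of `H`. An explicit computation inside a factor shows that this
image would then contain `G/R`.

Suppose that `G ≤ H R`. By minimality of `G`, `[G, x i] = G`, so that every subgroup containing all
conjugates of `x i` contains `G`. Enlarge `H` to a maximal subgroup `K` with `G ≰ K`, and let
`N ≤ R` be a minimal normal subgroup subject to `N ≰ K`. Then `G ≤ K N`, and `U = N / (N ∩ K)` is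
an abelian `l`-group for a prime `l`. The `v ∈ N` with `v (x i) v⁻¹ ∈ K` form a coset of the fixed
points of `x i` in a suitable action on `U`. These cosets do not cover `U`: in a minimal step
`V < W` of subgroups of `U` invariant under all `x i`, the fixed points of an `x i` with `q i ≠ l`
can have `W`-part `V` only if `|W : V| ≡ 1` modulo `q i`, so the distinct primes `q i < |W : V|`,
together with possibly `l`, give fewer than `|W : V|` cosets.
-/

section PrimaryElements

variable {X : Type*} [Group X]

theorem mem_of_pow_mem_of_pow_mem_of_coprime {C : Subgroup X} {y : X} {m n : ℕ}
    (hmn : m.Coprime n) (hm : y ^ m ∈ C) (hn : y ^ n ∈ C) : y ∈ C := by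
  have hgcd : y ^ ((m.gcd n : ℕ) : ℤ) ∈ C := by
    rw [Nat.gcd_eq_gcd_ab, zpow_add, zpow_mul, zpow_mul, zpow_natCast, zpow_natCast]
    exact mul_mem (zpow_mem hm _) (zpow_mem hn _)
  simpa [hmn.gcd_eq_one] using hgcd

/-- The element `w` is primary modulo `C` for the prime `q`: it has `q`-power order and order
exactly `q` modulo `C`. The order is expressed through membership in `C`, which need not be
normal. -/
structure IsPrimaryModulo (C : Subgroup X) (q : ℕ) (w : X) : Prop where
  prime : q.Prime
  notMem : w ∉ C
  pow_mem : w ^ q ∈ C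
  exists_pow_eq_one : ∃ k, w ^ q ^ k = 1

theorem exists_isPrimaryModulo_mem_zpowers [Finite X] {C : Subgroup X} {y : X} (hy : y ∉ C) :
    ∃ q, ∃ w ∈ Subgroup.zpowers y, IsPrimaryModulo C q w := by
  obtain ⟨w, ⟨hwy, hwC⟩, hmin⟩ := Set.exists_min_image
    {w | w ∈ Subgroup.zpowers y ∧ w ∉ C} orderOf (Set.toFinite _)
    ⟨y, Subgroup.mem_zpowers y, hy⟩
  have pow_mem_of_prime_dvd {q : ℕ} (hq : q.Prime) (hqw : q ∣ orderOf w) : w ^ q ∈ C := by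
    by_contra hwq
    have hle := hmin _ ⟨pow_mem hwy q, hwq⟩
    rw [orderOf_pow_of_dvd hq.ne_zero hqw] at hle
    exact hle.not_gt (Nat.div_lt_self (orderOf_pos w) hq.one_lt)
  have hne : orderOf w ≠ 1 := fun h => hwC (orderOf_eq_one_iff.1 h ▸ C.one_mem)
  obtain ⟨q, hq, hqw⟩ := Nat.exists_prime_and_dvd hne
  have unique_prime {d : ℕ} (hd : d.Prime) (hdw : d ∣ orderOf w) : d = q := by
    by_contra hdq
    exact hwC (mem_of_pow_mem_of_pow_mem_of_coprime ((Nat.coprime_primes hd hq).2 hdq)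
      (pow_mem_of_prime_dvd hd hdw) (pow_mem_of_prime_dvd hq hqw))
  exact ⟨q, w, hwy, hq, hwC, pow_mem_of_prime_dvd hq hqw, _,
    Nat.eq_prime_pow_of_unique_prime_dvd (orderOf_pos w).ne' unique_prime ▸ pow_orderOf_eq_one w⟩

theorem mem_zpowers_of_orderOf_dvd [Finite X] [IsCyclic X] {v w : X} (h : orderOf v ∣ orderOf w) :
    v ∈ Subgroup.zpowers w := by
  classical
  have := Fintype.ofFinite X
  let roots : Finset X := {a | a ^ orderOf w = 1}
  have hsub : (Subgroup.zpowers w : Set X).toFinset ⊆ roots := by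
    intro a ha
    obtain ⟨k, rfl⟩ : a ∈ Subgroup.zpowers w := by simpa using ha
    simp [roots, ← zpow_natCast (w ^ k), zpow_comm w k]
  have heq := Finset.eq_of_subset_of_card_le hsub <| by
    rw [Set.toFinset_card, ← Nat.card_eq_fintype_card, SetLike.coe_sort_coe, Nat.card_zpowers]
    exact IsCyclic.card_pow_eq_one_le (orderOf_pos w)
  have hv : v ∈ roots := by simpa [roots] using orderOf_dvd_iff_pow_eq_one.1 h
  simpa [← heq] using hv

namespace IsPrimaryModulo

variable {C : Subgroup X} {q : ℕ} {v w : X}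

theorem ne_one (hw : IsPrimaryModulo C q w) : w ≠ 1 := fun h => hw.notMem (h ▸ C.one_mem)

theorem exists_orderOf_eq (hw : IsPrimaryModulo C q w) : ∃ k, orderOf w = q ^ (k + 1) := by
  obtain ⟨n, hn⟩ := hw.exists_pow_eq_one
  obtain ⟨_ | k, -, hk⟩ := (Nat.dvd_prime_pow hw.prime).1 (orderOf_dvd_of_pow_eq_one hn)
  · exact (hw.ne_one (orderOf_eq_one_iff.1 hk)).elim
  · exact ⟨k, hk⟩

variable [Finite X] [IsCyclic X]

theorem orderOf_dvd_orderOf (hv : IsPrimaryModulo C q v) (hw : IsPrimaryModulo C q w) :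
    orderOf v ∣ orderOf w := by
  obtain ⟨a, ha⟩ := hv.exists_orderOf_eq
  obtain ⟨b, hb⟩ := hw.exists_orderOf_eq
  rw [ha, hb]
  refine pow_dvd_pow q ?_
  by_contra! hba
  have hvq : orderOf (v ^ q) = q ^ a := by
    rw [orderOf_pow_of_dvd hv.prime.ne_zero (ha ▸ dvd_pow_self q a.succ_ne_zero), ha, pow_succ,
      Nat.mul_div_cancel _ hv.prime.pos]
  have hwv : w ∈ Subgroup.zpowers (v ^ q) :=
    mem_zpowers_of_orderOf_dvd (by rw [hb, hvq]; exact pow_dvd_pow q (by omega))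
  exact hw.notMem ((Subgroup.zpowers_le.2 hv.pow_mem) hwv)

theorem mem_zpowers (hv : IsPrimaryModulo C q v) (hw : IsPrimaryModulo C q w) :
    v ∈ Subgroup.zpowers w :=
  mem_zpowers_of_orderOf_dvd (hv.orderOf_dvd_orderOf hw)

end IsPrimaryModulo

theorem exists_isPrimaryModulo_family [Finite X] [IsCyclic X] (C : Subgroup X) :
    ∃ (ι : Type) (_ : Finite ι) (q : ι → ℕ) (x : ι → X), q.Injective ∧
      (∀ i, IsPrimaryModulo C (q i) (x i)) ∧ ∀ y ∉ C, ∃ i, x i ∈ Subgroup.zpowers y := by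
  let ι := {q : ℕ // ∃ w, IsPrimaryModulo C q w}
  choose x hx using fun i : ι => i.2
  have hinj : x.Injective := by
    intro i j hij
    by_contra hne
    refine (hx i).notMem (mem_of_pow_mem_of_pow_mem_of_coprime ?_ (hx i).pow_mem
      (hij ▸ (hx j).pow_mem))
    exact (Nat.coprime_primes (hx i).prime (hx j).prime).2 fun h => hne (Subtype.ext h)
  refine ⟨ι, Finite.of_injective x hinj, Subtype.val, x, Subtype.val_injective, hx, ?_⟩
  intro y hy
  obtain ⟨q, w, hwy, hw⟩ := exists_isPrimaryModulo_mem_zpowers hy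
  exact ⟨⟨q, w, hw⟩, (Subgroup.zpowers_le.2 hwy) ((hx ⟨q, w, hw⟩).mem_zpowers hw)⟩

end PrimaryElements

section SimpleQuotients

namespace IsNonabelianSimple

variable {T : Type*} [Group T]

theorem center_eq_bot (hT : IsNonabelianSimple T) : Subgroup.center T = ⊥ := by
  have := hT.1
  obtain ⟨a, b, hab⟩ := hT.2
  have hnormal : (Subgroup.center T).Normal := inferInstance
  refine hnormal.eq_bot_or_eq_top.resolve_right fun htop => ?_
  exact hab (Subgroup.mem_center_iff.1 (htop ▸ Subgroup.mem_top b) a)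

theorem isPerfect (hT : IsNonabelianSimple T) : Group.IsPerfect T := by
  have := hT.1
  have hnormal : (commutator T).Normal := inferInstance
  refine ⟨hnormal.eq_bot_or_eq_top.resolve_left fun hbot => ?_⟩
  exact bot_ne_top
    (hT.center_eq_bot.symm.trans ((commutator_eq_bot_iff_center_eq_top T).1 hbot))

theorem exists_mul_self_ne_one (hT : IsNonabelianSimple T) : ∃ t : T, t * t ≠ 1 := by
  by_contra! h
  obtain ⟨a, b, hab⟩ := hT.2
  have hinv (t : T) : t⁻¹ = t := inv_eq_of_mul_eq_one_left (h t)
  rw [← hinv (a * b), mul_inv_rev, hinv, hinv] at hab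
  exact hab rfl

variable {G : Type*} [Group G] {f : G →* T}

theorem map_eq_top (hT : IsNonabelianSimple T) (hf : Function.Surjective f) {N : Subgroup G}
    [hN : N.Normal] (hNf : ¬ N ≤ f.ker) : N.map f = ⊤ := by
  have := hT.1
  exact (hN.map f hf).eq_bot_or_eq_top.resolve_left fun h => hNf ((Subgroup.map_eq_bot_iff N).1 h)

theorem not_inf_le_ker (hT : IsNonabelianSimple T) (hf : Function.Surjective f)
    {M N : Subgroup G} [M.Normal] [N.Normal] (hM : ¬ M ≤ f.ker) (hN : ¬ N ≤ f.ker) :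
    ¬ M ⊓ N ≤ f.ker := by
  have := hT.1
  intro hMN
  have hbot : ⁅M, N⁆.map f = ⊥ :=
    (Subgroup.map_eq_bot_iff _).2 ((Subgroup.commutator_le_inf M N).trans hMN)
  rw [Subgroup.map_commutator, hT.map_eq_top hf hM, hT.map_eq_top hf hN] at hbot
  exact bot_ne_top (hbot.symm.trans hT.isPerfect.commutator_eq_top)

theorem not_biInf_le_ker {ι : Type*} (hT : IsNonabelianSimple T) (hf : Function.Surjective f)
    {s : Set ι} (hs : s.Finite) {N : ι → Subgroup G} (hnormal : ∀ i, (N i).Normal)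
    (hN : ∀ i ∈ s, ¬ N i ≤ f.ker) : ¬ ⨅ i ∈ s, N i ≤ f.ker := by
  induction s, hs using Set.Finite.induction_on with
  | empty =>
    obtain ⟨t, ht⟩ := hT.exists_mul_self_ne_one
    obtain ⟨a, rfl⟩ := hf t
    intro h
    have ha : f a = 1 := h (by simp)
    exact ht (by rw [ha, mul_one])
  | @insert i s _ _ ih =>
    have : (⨅ j ∈ s, N j).Normal :=
      Subgroup.normal_iInf_normal fun j => Subgroup.normal_iInf_normal fun _ => hnormal j
    rw [iInf_insert]
    exact hT.not_inf_le_ker hf (hN i (Set.mem_insert i s))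
      (ih fun j hj => hN j (Set.mem_insert_of_mem i hj))

end IsNonabelianSimple

theorem sup_biInf_ker_eq_top {ι G : Type*} {T : ι → Type*} [Group G] [∀ i, Group (T i)]
    (hT : ∀ i, IsNonabelianSimple (T i)) {f : ∀ i, G →* T i}
    (hf : ∀ i, Function.Surjective (f i)) {E : Subgroup G} [E.Normal] {s : Set ι} (hs : s.Finite)
    (hE : ∀ i ∈ s, ¬ E ≤ (f i).ker) : E ⊔ ⨅ i ∈ s, (f i).ker = ⊤ := by
  induction s, hs using Set.Finite.induction_on with
  | empty => simp
  | @insert i s _ _ ih =>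
    set M := ⨅ j ∈ s, (f j).ker
    have hMnormal : M.Normal :=
      Subgroup.normal_iInf_normal fun j => Subgroup.normal_iInf_normal fun _ => (f j).normal_ker
    have hEM : E ⊔ M = ⊤ := ih fun j hj => hE j (Set.mem_insert_of_mem i hj)
    rw [iInf_insert]
    by_cases hM : M ≤ (f i).ker
    · rwa [inf_eq_right.2 hM]
    have hmap : (E ⊓ M).map (f i) = ⊤ := (hT i).map_eq_top (hf i)
      ((hT i).not_inf_le_ker (hf i) (hE i (Set.mem_insert i s)) hM)
    refine eq_top_iff.2 (hEM.ge.trans (sup_le le_sup_left fun m hm => ?_))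
    obtain ⟨e, he, hem⟩ : f i m ∈ (E ⊓ M).map (f i) := hmap ▸ Subgroup.mem_top _
    have hker : e⁻¹ * m ∈ (f i).ker ⊓ M := Subgroup.mem_inf.2
      ⟨by rw [MonoidHom.mem_ker, map_mul, map_inv, hem, inv_mul_cancel],
        M.mul_mem (M.inv_mem he.2) hm⟩
    simpa using Subgroup.mul_mem_sup he.1 hker

theorem eq_top_of_iInf_ker_eq_bot {ι G : Type*} {T : ι → Type*} [Finite ι] [Group G]
    [∀ i, Group (T i)] (hT : ∀ i, IsNonabelianSimple (T i)) {f : ∀ i, G →* T i}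
    (hf : ∀ i, Function.Surjective (f i)) (hbot : ⨅ i, (f i).ker = ⊥) {E : Subgroup G} [E.Normal]
    (hE : ∀ i, ¬ E ≤ (f i).ker) : E = ⊤ := by
  simpa [hbot] using sup_biInf_ker_eq_top hT hf Set.finite_univ fun i _ => hE i

end SimpleQuotients

section AutCommutator

/-- The commutator subgroup `[G, σ]` of a group `G` with an automorphism `σ`, generated by the
elements `z · σ(z)⁻¹`. -/
def autCommutator {G : Type*} [Group G] (σ : MulAut G) : Subgroup G :=
  Subgroup.closure (Set.range fun z => z * (σ z)⁻¹)

variable {G Q : Type*} [Group G] [Group Q] {σ : MulAut G}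

theorem autCommutator_le {K : Subgroup G} : autCommutator σ ≤ K ↔ ∀ z, z * (σ z)⁻¹ ∈ K := by
  rw [autCommutator, Subgroup.closure_le, Set.range_subset_iff]
  rfl

theorem mul_inv_mem_autCommutator (σ : MulAut G) (z : G) : z * (σ z)⁻¹ ∈ autCommutator σ :=
  autCommutator_le.1 le_rfl z

instance autCommutator_normal (σ : MulAut G) : (autCommutator σ).Normal := by
  refine ⟨fun n hn a => ?_⟩
  have hle : autCommutator σ ≤ (autCommutator σ).comap (MulAut.conj a).toMonoidHom := by
    refine autCommutator_le.2 fun z => ?_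
    have hmem := mul_mem (mul_inv_mem_autCommutator σ (a * z))
      (inv_mem (mul_inv_mem_autCommutator σ a))
    simpa [mul_assoc] using hmem
  exact hle hn

theorem autCommutator_eq_bot_iff : autCommutator σ = ⊥ ↔ σ = 1 := by
  rw [eq_bot_iff, autCommutator_le, MulEquiv.ext_iff]
  refine forall_congr' fun z => ?_
  rw [Subgroup.mem_bot, mul_inv_eq_one, eq_comm, MulAut.one_apply]

theorem map_autCommutator {π : G →* Q} (hπ : Function.Surjective π) {τ : MulAut Q}
    (hcomm : ∀ a, π (σ a) = τ (π a)) : (autCommutator σ).map π = autCommutator τ := by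
  rw [autCommutator, autCommutator, MonoidHom.map_closure, ← Set.range_comp]
  congr 1
  ext a
  simp [hπ.exists, hcomm]

theorem smul_autCommutator_of_commute {τ : MulAut G} (hστ : Commute σ τ) :
    τ • autCommutator σ = autCommutator σ :=
  map_autCommutator τ.surjective fun a => (DFunLike.congr_fun hστ a).symm

end AutCommutator

section FaithfulProjection

variable {X G T : Type*} [Group X] [Group G] [Group T]

/-- The composite `f ∘ φ y` of a homomorphism `f` defined on `G` with the automorphism by which `y`
acts on `G`. -/
def twist (φ : X →* MulAut G) (f : G →* T) (y : X) : G →* T :=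
  f.comp (φ y).toMonoidHom

/-- The stabilizer of the kernel of `f` in the group `X` acting on `G` through `φ`. -/
def kerStabilizer (φ : X →* MulAut G) (f : G →* T) : Subgroup X :=
  (MulAction.stabilizer (MulAut G) f.ker).comap φ

/-- The intersection of the kernels of the twists of `f` that differ from the kernel of `f`.
When `f` is a coordinate projection of a direct product of simple groups permuted by `X`, this is
the corresponding factor. -/
def factor (φ : X →* MulAut G) (f : G →* T) : Subgroup G :=
  ⨅ y ∈ (kerStabilizer φ f : Set X)ᶜ, (twist φ f y).ker

/-- The homomorphism `f` is surjective and its twists by the action `φ` of `X` separate the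
points of `G`. For `T` nonabelian simple, this says that `G` is a direct product of copies of `T`
permuted transitively by `X`, one of whose coordinate projections is `f`. -/
structure IsFaithfulProjection (φ : X →* MulAut G) (f : G →* T) : Prop where
  surjective : Function.Surjective f
  iInf_ker_eq_bot : ⨅ y, (twist φ f y).ker = ⊥

variable {φ : X →* MulAut G} {f : G →* T}

@[simp]
theorem twist_apply (y : X) (a : G) : twist φ f y a = f (φ y a) := rfl

theorem twist_twist (y z : X) :
    twist φ (twist φ f y) z = twist φ f (y * z) := by
  ext a
  simp

theorem mem_kerStabilizer {y : X} : y ∈ kerStabilizer φ f ↔ ∀ a, f (φ y a) = 1 ↔ f a = 1 := by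
  rw [kerStabilizer, Subgroup.mem_comap, ← inv_mem_iff, MulAction.mem_stabilizer_iff,
    SetLike.ext_iff]
  simp [Subgroup.mem_pointwise_smul_iff_inv_smul_mem]

theorem kerStabilizer_twist [IsMulCommutative X] (y : X) :
    kerStabilizer φ (twist φ f y) = kerStabilizer φ f := by
  ext z
  have hcomm (a : G) : φ y (φ z a) = φ z (φ y a) := by
    rw [← MulAut.mul_apply, ← map_mul, mul_comm', map_mul, MulAut.mul_apply]
  simp only [mem_kerStabilizer, twist_apply, hcomm, (φ y).surjective.forall (p := fun a =>
    f (φ z a) = 1 ↔ f a = 1)]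

theorem mem_kerStabilizer_of_ker_le [Finite G] {y : X} (h : (twist φ f y).ker ≤ f.ker) :
    y ∈ kerStabilizer φ f := by
  have hker : (twist φ f y).ker = (φ y)⁻¹ • f.ker := by
    ext a
    simp [Subgroup.mem_pointwise_smul_iff_inv_smul_mem, MonoidHom.mem_ker]
  have heq := Subgroup.eq_of_le_of_card_ge h
    (by rw [hker]; exact (Nat.card_congr (Subgroup.equivSMul (φ y)⁻¹ f.ker).toEquiv).le)
  exact mem_kerStabilizer.2 fun a => SetLike.ext_iff.1 heq a

theorem mem_factor {a : G} : a ∈ factor φ f ↔ ∀ y ∉ kerStabilizer φ f, f (φ y a) = 1 := by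
  simp [factor, Subgroup.mem_iInf, MonoidHom.mem_ker]

instance factor_normal : (factor φ f).Normal :=
  Subgroup.normal_iInf_normal fun y => Subgroup.normal_iInf_normal fun _ =>
    (twist φ f y).normal_ker

namespace IsFaithfulProjection

variable (h : IsFaithfulProjection φ f)
include h

theorem eq_one {a : G} (ha : ∀ y, f (φ y a) = 1) : a = 1 := by
  rw [← Subgroup.mem_bot, ← h.iInf_ker_eq_bot]
  exact Subgroup.mem_iInf.2 ha

protected theorem twist (y : X) : IsFaithfulProjection φ (twist φ f y) where
  surjective := h.surjective.comp (φ y).surjective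
  iInf_ker_eq_bot := by
    simp_rw [twist_twist]
    rw [← h.iInf_ker_eq_bot]
    exact (Equiv.mulLeft y).iInf_comp (g := fun z => (twist φ f z).ker)

theorem disjoint_factor_ker : Disjoint (factor φ f) f.ker := by
  rw [Subgroup.disjoint_def]
  intro a haL hak
  refine h.eq_one fun y => ?_
  by_cases hy : y ∈ kerStabilizer φ f
  · exact (mem_kerStabilizer.1 hy a).2 hak
  · exact mem_factor.1 haL y hy

theorem commute_factor_ker {s k : G} (hs : s ∈ factor φ f) (hk : f k = 1) : Commute s k :=
  Subgroup.commute_of_normal_of_disjoint _ _ inferInstance f.normal_ker h.disjoint_factor_ker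
    s k hs hk

theorem injOn_factor : Set.InjOn f (factor φ f) := by
  intro s hs t ht hst
  rw [← mul_inv_eq_one]
  refine Subgroup.disjoint_def.1 h.disjoint_factor_ker (mul_mem hs (inv_mem ht)) ?_
  rw [MonoidHom.mem_ker, map_mul, map_inv, hst, mul_inv_cancel]

theorem eq_top_of_normal_of_invariant [Finite X] (hT : IsNonabelianSimple T) {E : Subgroup G}
    [E.Normal] (hE : E ≠ ⊥) (hinv : ∀ y, ∀ e ∈ E, φ y e ∈ E) : E = ⊤ := by
  refine eq_top_of_iInf_ker_eq_bot (fun _ => hT) (fun y => (h.twist y).surjective)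
    h.iInf_ker_eq_bot fun y hy => hE ((Subgroup.eq_bot_iff_forall E).2 fun e he => ?_)
  refine h.eq_one fun z => ?_
  have hz : f (φ y (φ (y⁻¹ * z) e)) = 1 := hy (hinv (y⁻¹ * z) e he)
  simpa using hz

variable [Finite G] [Finite X] (hT : IsNonabelianSimple T)
include hT

theorem map_factor : (factor φ f).map f = ⊤ := by
  refine hT.map_eq_top h.surjective (hT.not_biInf_le_ker h.surjective (Set.toFinite _)
    (fun y => (twist φ f y).normal_ker) fun y hy hle => hy ?_)
  exact mem_kerStabilizer_of_ker_le hle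

theorem exists_mem_factor (t : T) : ∃ s ∈ factor φ f, f s = t :=
  Subgroup.mem_map.1 (h.map_factor hT ▸ Subgroup.mem_top t)

theorem iSup_factor_eq_top : ⨆ y, factor φ (twist φ f y) = ⊤ := by
  have hnormal : (⨆ y, factor φ (twist φ f y)).Normal := inferInstance
  refine eq_top_of_iInf_ker_eq_bot (fun _ => hT) (fun y => (h.twist y).surjective)
    h.iInf_ker_eq_bot fun y hle => ?_
  have := hT.1
  have hbot := (Subgroup.map_eq_bot_iff _).2 ((le_iSup _ y).trans hle)
  exact bot_ne_top (hbot.symm.trans ((h.twist y).map_factor hT))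

end IsFaithfulProjection

end FaithfulProjection

section FixedSubgroup

variable {X G T : Type*} [Group X] [Group G] [Group T]

/-- The subgroup of the elements of `G` fixed by the automorphism `σ`. -/
def fixedSubgroup (σ : MulAut G) : Subgroup G :=
  σ.toMonoidHom.eqLocus (MonoidHom.id G)

theorem mem_fixedSubgroup {σ : MulAut G} {a : G} : a ∈ fixedSubgroup σ ↔ σ a = a := Iff.rfl

/-- The action on the fixed points of `φ x` induced by an action `φ` of a commutative group. -/
def fixedAction [IsMulCommutative X] (φ : X →* MulAut G) (x : X) :
    X →* MulAut (fixedSubgroup (φ x)) :=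
  have hinv (y : X) {a : G} (ha : a ∈ fixedSubgroup (φ x)) : φ y a ∈ fixedSubgroup (φ x) := by
    rw [mem_fixedSubgroup, ← MulAut.mul_apply, ← map_mul, mul_comm', map_mul, MulAut.mul_apply,
      mem_fixedSubgroup.1 ha]
  { toFun y :=
      { toFun a := ⟨φ y a, hinv y a.2⟩
        invFun a := ⟨φ y⁻¹ a, hinv y⁻¹ a.2⟩
        left_inv a := by simp
        right_inv a := by simp
        map_mul' a b := by simp }
    map_one' := by ext; simp
    map_mul' y z := by ext; simp }

@[simp]
theorem coe_fixedAction [IsMulCommutative X] (φ : X →* MulAut G) (x y : X)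
    (a : fixedSubgroup (φ x)) : (fixedAction φ x y a : G) = φ y a := rfl

theorem fixedAction_self [IsMulCommutative X] (φ : X →* MulAut G) (x : X) :
    fixedAction φ x x = 1 := by
  ext a
  exact a.2

theorem card_fixedSubgroup_lt [Finite G] {σ : MulAut G} (hσ : σ ≠ 1) :
    Nat.card (fixedSubgroup σ) < Nat.card G := by
  refine (Subgroup.card_le_card_group _).lt_of_ne fun h => hσ (MulEquiv.ext fun a => ?_)
  exact mem_fixedSubgroup.1 ((Subgroup.card_eq_iff_eq_top _).1 h ▸ Subgroup.mem_top a)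

theorem fixedAction_pow_eq_one [IsMulCommutative X] {φ : X →* MulAut G} {x y : X} {n : ℕ}
    (h : φ y ^ n = 1) : fixedAction φ x y ^ n = 1 := by
  rw [← map_pow] at h ⊢
  ext a
  rw [coe_fixedAction, h, MulAut.one_apply, MulAut.one_apply]

/-- The ordered product `s · σ(s) ⋯ σⁿ⁻¹(s)`. -/
def orbitProd (σ : MulAut G) (s : G) (n : ℕ) : G :=
  ((List.range n).map fun j => (σ ^ j) s).prod

theorem orbitProd_succ (σ : MulAut G) (s : G) (n : ℕ) :
    orbitProd σ s (n + 1) = orbitProd σ s n * (σ ^ n) s := by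
  simp [orbitProd, List.prod_range_succ]

theorem orbitProd_succ' (σ : MulAut G) (s : G) (n : ℕ) :
    orbitProd σ s (n + 1) = s * σ (orbitProd σ s n) := by
  simp [orbitProd, List.prod_range_succ', map_list_prod, Function.comp_def, pow_succ']

theorem map_orbitProd_eq_one {f : G →* T} {σ : MulAut G} {s : G} {n : ℕ}
    (hs : ∀ j < n, f ((σ ^ j) s) = 1) : f (orbitProd σ s n) = 1 := by
  rw [orbitProd, map_list_prod, List.map_map]
  exact List.prod_eq_one (by simpa using hs)

theorem pow_notMem_kerStabilizer {φ : X →* MulAut G} {f : G →* T} {x : X} {q : ℕ}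
    (hq : q.Prime) (hxq : φ x ^ q = 1) (hx : x ∉ kerStabilizer φ f) {j : ℕ} (hj : j ≠ 0)
    (hjq : j < q) : x ^ j ∉ kerStabilizer φ f := fun hxj => by
  refine hx (mem_of_pow_mem_of_pow_mem_of_coprime (Nat.coprime_of_lt_prime hj hjq hq).symm hxj ?_)
  simp [mem_kerStabilizer, hxq]

/-- The witness is the product of the `x`-orbit of `s`, an element of a diagonal subgroup of the
product of the factors in one cycle of `x`. -/
theorem IsFaithfulProjection.exists_mem_fixedSubgroup {φ : X →* MulAut G} {f : G →* T}
    (h : IsFaithfulProjection φ f) {x : X} {q : ℕ} (hq : q.Prime) (hxq : φ x ^ q = 1)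
    (hx : x ∉ kerStabilizer φ f) {s : G} (hs : s ∈ factor φ f) :
    ∃ n ∈ fixedSubgroup (φ x), f n = f s ∧
      ∀ y, (∀ j : ℕ, y * x ^ j ∉ kerStabilizer φ f) → f (φ y n) = 1 := by
  obtain ⟨m, rfl⟩ : ∃ m, q = m + 1 := ⟨q - 1, (Nat.sub_add_cancel hq.pos).symm⟩
  have htail : f (φ x (orbitProd (φ x) s m)) = 1 := by
    refine map_orbitProd_eq_one (f := f.comp (φ x).toMonoidHom) fun j hj => ?_
    have := mem_factor.1 hs _ (pow_notMem_kerStabilizer hq hxq hx j.succ_ne_zero (by omega))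
    simpa [pow_succ'] using this
  have hsplit := orbitProd_succ' (φ x) s m
  refine ⟨orbitProd (φ x) s (m + 1), mem_fixedSubgroup.2 (mul_left_cancel (a := s) ?_), ?_,
    fun y hy => ?_⟩
  · rw [← orbitProd_succ', orbitProd_succ, hxq, MulAut.one_apply, hsplit, mul_assoc,
      (h.commute_factor_ker hs htail).eq]
  · rw [hsplit, map_mul, htail, mul_one]
  · refine map_orbitProd_eq_one (f := twist φ f y) fun j _ => ?_
    simpa using mem_factor.1 hs _ (hy j)

namespace IsFaithfulProjection

variable {φ : X →* MulAut G} {f : G →* T} (h : IsFaithfulProjection φ f)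
  (hT : IsNonabelianSimple T) [Finite G] [Finite X] {x : X} {q : ℕ}
  (hq : q.Prime) (hxq : φ x ^ q = 1) (hx : x ∉ kerStabilizer φ f)
include h hT hq hxq hx

theorem surjective_fixedSubgroup :
    Function.Surjective (f.comp (fixedSubgroup (φ x)).subtype) := fun t => by
  obtain ⟨s, hs, rfl⟩ := h.exists_mem_factor hT t
  obtain ⟨n, hn, hns, -⟩ := h.exists_mem_fixedSubgroup hq hxq hx hs
  exact ⟨⟨n, hn⟩, hns⟩

theorem map_eq_top_of_fixedSubgroup_le {B : Subgroup G} (hB : fixedSubgroup (φ x) ≤ B) :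
    B.map f = ⊤ := by
  refine eq_top_iff.2 fun t _ => ?_
  obtain ⟨d, rfl⟩ := h.surjective_fixedSubgroup hT hq hxq hx t
  exact ⟨d, hB d.2, rfl⟩

variable [IsMulCommutative X]

protected theorem fixedAction : IsFaithfulProjection (fixedAction φ x)
    (f.comp (fixedSubgroup (φ x)).subtype) where
  surjective := h.surjective_fixedSubgroup hT hq hxq hx
  iInf_ker_eq_bot := by
    refine (Subgroup.eq_bot_iff_forall _).2 fun a ha => Subtype.ext (h.eq_one fun y => ?_)
    exact Subgroup.mem_iInf.1 ha y

theorem exists_mul_pow_mem_kerStabilizer {y : X}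
    (hy : y ∈ kerStabilizer (fixedAction φ x) (f.comp (fixedSubgroup (φ x)).subtype)) :
    ∃ j : ℕ, y * x ^ j ∈ kerStabilizer φ f := by
  by_contra! hyj
  obtain ⟨t, ht⟩ := hT.exists_mul_self_ne_one
  obtain ⟨s, hs, rfl⟩ := h.exists_mem_factor hT t
  obtain ⟨n, hn, hns, hny⟩ := h.exists_mem_fixedSubgroup hq hxq hx hs
  have hfs : f s = 1 := hns ▸ (mem_kerStabilizer.1 hy ⟨n, hn⟩).1 (hny y hyj)
  exact ht (by rw [hfs, mul_one])

theorem map_eq_one_of_fixedAction_eq_one {w : X} (hw : w ∈ kerStabilizer φ f)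
    (hwD : fixedAction φ x w = 1) : φ w = 1 := by
  refine MulEquiv.ext fun a => mul_inv_eq_one.1 (h.eq_one fun y => ?_)
  rw [← kerStabilizer_twist y] at hx hw
  obtain ⟨⟨n, hn⟩, hna⟩ := (h.twist y).surjective_fixedSubgroup hT hq hxq hx (f (φ y a))
  replace hna : f (φ y n) = f (φ y a) := hna
  have hwn : φ w n = n := by
    simpa using congrArg Subtype.val (DFunLike.congr_fun hwD ⟨n, hn⟩)
  have hker : f (φ y (n⁻¹ * a)) = 1 := by simp [hna]
  have hwker : f (φ y (φ w (n⁻¹ * a))) = 1 := (mem_kerStabilizer.1 hw _).2 hker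
  simp only [map_mul, map_inv, hwn] at hwker
  simp [← inv_mul_eq_one.1 hwker, hna]

end IsFaithfulProjection

end FixedSubgroup

section ConjugatesOfComplement

open SemidirectProduct

variable {X G T : Type*} [Group X] [Group G] [Group T] {φ : X →* MulAut G} {f : G →* T}
  {H : Subgroup (G ⋊[φ] X)} {x : X}

theorem inl_mul_inl_mem_of_conj_inr_mem {z t : G} (hz : inl z * inr x * (inl z)⁻¹ ∈ H)
    (ht : inl t * inr x * (inl t)⁻¹ ∈ H) : inl (z * φ x (z⁻¹ * t) * t⁻¹) ∈ H := by
  simpa [mul_assoc, inl_aut] using mul_mem hz (inv_mem ht)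

theorem autCommutator_le_comap_inl (h : ∀ z : G, inl z * inr x * (inl z)⁻¹ ∈ H) :
    autCommutator (φ x) ≤ H.comap inl := by
  refine autCommutator_le.2 fun z => ?_
  simpa using inl_mul_inl_mem_of_conj_inr_mem (h z) (h 1)

theorem inl_range_le_iff_comap_inl : (inl : G →* G ⋊[φ] X).range ≤ H ↔ H.comap inl = ⊤ := by
  rw [MonoidHom.range_eq_map, Subgroup.map_le_iff_le_comap, top_le_iff]

namespace IsFaithfulProjection

variable (h : IsFaithfulProjection φ f) (hT : IsNonabelianSimple T)
include h hT

theorem autCommutator_eq_top [Finite X] [IsMulCommutative X] (hx : φ x ≠ 1) :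
    autCommutator (φ x) = ⊤ := by
  refine h.eq_top_of_normal_of_invariant hT (autCommutator_eq_bot_iff.not.2 hx) fun y e he => ?_
  have hxy : Commute x y := mul_comm' x y
  rw [← smul_autCommutator_of_commute (hxy.map φ)]
  exact Subgroup.smul_mem_pointwise_smul e _ _ he

theorem inl_range_le_of_forall_conj_inr_mem [Finite X] [IsMulCommutative X] (hx : φ x ≠ 1)
    (hconj : ∀ z : G, inl z * inr x * (inl z)⁻¹ ∈ H) : (inl : G →* G ⋊[φ] X).range ≤ H := by
  rw [inl_range_le_iff_comap_inl, ← top_le_iff, ← h.autCommutator_eq_top hT hx]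
  exact autCommutator_le_comap_inl hconj

theorem factor_le_of_not_disjoint {B : Subgroup G} (hB : B.map f = ⊤)
    (hLB : ¬ Disjoint (factor φ f) B) : factor φ f ≤ B := by
  have := hT.1
  have hnormal : ((factor φ f ⊓ B).map f).Normal := by
    refine ⟨?_⟩
    rintro _ ⟨s, hs, rfl⟩ t
    obtain ⟨b, hb, rfl⟩ : t ∈ B.map f := hB ▸ Subgroup.mem_top t
    refine ⟨b * s * b⁻¹, ⟨factor_normal.conj_mem s hs.1 b, ?_⟩, by simp⟩
    exact B.mul_mem (B.mul_mem hb hs.2) (B.inv_mem hb)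
  have hne : (factor φ f ⊓ B).map f ≠ ⊥ := fun hbot => by
    refine hLB (disjoint_iff.2 (eq_bot_iff.2 fun s hs => ?_))
    exact Subgroup.disjoint_def.1 h.disjoint_factor_ker hs.1
      ((Subgroup.map_eq_bot_iff _).1 hbot hs)
  intro s hs
  obtain ⟨b, hb, hbs⟩ : f s ∈ (factor φ f ⊓ B).map f :=
    hnormal.eq_bot_or_eq_top.resolve_left hne ▸ Subgroup.mem_top _
  exact h.injOn_factor hb.1 hs hbs ▸ hb.2

omit h hT in
theorem map_mem_factor_twist_inv [IsMulCommutative X] {c : G} (hc : c ∈ factor φ f) :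
    φ x c ∈ factor φ (twist φ f x⁻¹) := by
  refine mem_factor.2 fun y hy => ?_
  rw [kerStabilizer_twist] at hy
  have hyx : (x⁻¹ * y) * x = y := by rw [mul_comm' x⁻¹ y, inv_mul_cancel_right]
  rw [twist_apply, ← MulAut.mul_apply, ← MulAut.mul_apply, ← map_mul, ← map_mul, hyx]
  exact mem_factor.1 hc y hy

section Dichotomy

variable [Finite G] [Finite X] {q : ℕ} (hq : q.Prime) (hxq : φ x ^ q = 1)
  (hx : x ∉ kerStabilizer φ f)
  (hfixed : fixedSubgroup (φ x) ≤ H.comap inl)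
  (hdich : ∀ z : G, inl z * inr x * (inl z)⁻¹ ∈ H ∨
    ∀ d ∈ fixedSubgroup (φ x), z * d * z⁻¹ ∈ H.comap inl)
include hq hxq hx hfixed hdich

theorem conj_inr_mem_of_disjoint (hdisj : Disjoint (factor φ f) (H.comap inl)) {s : G}
    (hs : s ∈ factor φ f) (hs1 : s ≠ 1) : inl s * inr x * (inl s)⁻¹ ∈ H := by
  refine (hdich s).resolve_right fun hsd => hs1 ?_
  have hcomm (d : G) (hd : d ∈ fixedSubgroup (φ x)) : s * d * s⁻¹ * d⁻¹ = 1 := by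
    refine Subgroup.disjoint_def.1 hdisj ?_ (mul_mem (hsd d hd) (inv_mem (hfixed hd)))
    rw [mul_assoc, mul_assoc, ← mul_assoc d]
    exact mul_mem hs (factor_normal.conj_mem _ (inv_mem hs) d)
  have hcenter : f s ∈ Subgroup.center T := Subgroup.mem_center_iff.2 fun t => by
    obtain ⟨⟨d, hd⟩, rfl⟩ := h.surjective_fixedSubgroup hT hq hxq hx t
    have hds : d * s = s * d := (mul_inv_eq_iff_eq_mul.1 (mul_inv_eq_one.1 (hcomm d hd))).symm
    simpa using congrArg f hds
  rw [hT.center_eq_bot, Subgroup.mem_bot, ← map_one f] at hcenter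
  exact h.injOn_factor hs (one_mem (factor φ f)) hcenter

/-- If `a = s t⁻¹ = s' t'⁻¹` with all four elements nontrivial in the factor, then
`φ x (s⁻¹ t) a` and `φ x (s'⁻¹ t') a` lie in `H`, hence so does the `φ x`-image of their quotient.
The two factorizations used are `s (a⁻¹ s)⁻¹` and `a⁻¹ (a⁻²)⁻¹`. -/
theorem exists_map_mem_of_disjoint (hdisj : Disjoint (factor φ f) (H.comap inl)) :
    ∃ c ∈ factor φ f, c ≠ 1 ∧ φ x c ∈ H.comap inl := by
  have hmem {s t : G} (hs : s ∈ factor φ f) (hs1 : s ≠ 1) (ht : t ∈ factor φ f) (ht1 : t ≠ 1) :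
      φ x (s⁻¹ * t) * (s * t⁻¹) ∈ H.comap inl := by
    have hker : f (φ x (s⁻¹ * t)) = 1 := mem_factor.1 (mul_mem (inv_mem hs) ht) x hx
    rw [← mul_assoc, ← (h.commute_factor_ker hs hker).eq]
    exact inl_mul_inl_mem_of_conj_inr_mem
      (h.conj_inr_mem_of_disjoint hT hq hxq hx hfixed hdich hdisj hs hs1)
      (h.conj_inr_mem_of_disjoint hT hq hxq hx hfixed hdich hdisj ht ht1)
  obtain ⟨t, ht⟩ := hT.exists_mul_self_ne_one
  obtain ⟨a, ha, rfl⟩ := h.exists_mem_factor hT t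
  have haa : a * a ≠ 1 := fun haa => ht (by rw [← map_mul, haa, map_one])
  have ha1 : a ≠ 1 := fun ha1 => haa (by rw [ha1, mul_one])
  have hcenter : f a ∉ Subgroup.center T := by
    rw [hT.center_eq_bot, Subgroup.mem_bot]
    exact fun hfa => ht (by rw [hfa, mul_one])
  obtain ⟨u, hu⟩ := not_forall.1 (Subgroup.mem_center_iff.not.1 hcenter)
  obtain ⟨s, hs, rfl⟩ := h.exists_mem_factor hT u
  have hsa : s * a ≠ a * s := fun hsa => hu (by rw [← map_mul, hsa, map_mul])
  have hs1 : s ≠ 1 := fun hs1 => hsa (by rw [hs1, one_mul, mul_one])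
  have has : a⁻¹ * s ≠ 1 := fun has => hsa (by rw [inv_mul_eq_one.1 has])
  have haa' : a⁻¹ * a⁻¹ ≠ 1 := fun h' => haa (by rw [← inv_inj, mul_inv_rev, h', inv_one])
  have ha' := inv_mem ha
  refine ⟨s⁻¹ * a⁻¹ * s * a, mul_mem (mul_mem (mul_mem (inv_mem hs) ha') hs) ha, fun hc => ?_, ?_⟩
  · refine hsa ?_
    rw [mul_assoc, mul_assoc, inv_mul_eq_one] at hc
    exact (eq_inv_mul_iff_mul_eq.1 hc).symm
  · have := mul_mem (hmem hs hs1 (mul_mem ha' hs) has)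
      (inv_mem (hmem ha' (inv_ne_one.2 ha1) (mul_mem ha' ha') haa'))
    simpa [mul_assoc] using this

theorem factor_le [IsMulCommutative X] : factor φ f ≤ H.comap inl := by
  by_contra hle
  have hdisj : Disjoint (factor φ f) (H.comap inl) := by
    by_contra hdisj
    exact hle (h.factor_le_of_not_disjoint hT
      (h.map_eq_top_of_fixedSubgroup_le hT hq hxq hx hfixed) hdisj)
  obtain ⟨c, hc, hc1, hcH⟩ := h.exists_map_mem_of_disjoint hT hq hxq hx hfixed hdich hdisj
  have hx' : x ∉ kerStabilizer φ (twist φ f x⁻¹) := by rwa [kerStabilizer_twist]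
  have hle' : factor φ (twist φ f x⁻¹) ≤ H.comap inl := by
    refine (h.twist x⁻¹).factor_le_of_not_disjoint hT
      ((h.twist x⁻¹).map_eq_top_of_fixedSubgroup_le hT hq hxq hx' hfixed) fun hdisj' => hc1 ?_
    simpa using Subgroup.disjoint_def.1 hdisj' (map_mem_factor_twist_inv hc) hcH
  refine hle fun l hl => ?_
  set k : G ⋊[φ] X := inl c * inr x * (inl c)⁻¹
  have hk : k ∈ H := h.conj_inr_mem_of_disjoint hT hq hxq hx hfixed hdich hdisj hc hc1
  have hl' : c⁻¹ * l * c ∈ factor φ f := mul_mem (mul_mem (inv_mem hc) hl) hc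
  have hcomm := (h.commute_factor_ker hc (mem_factor.1 hl' x hx)).eq
  have hconj : inl l = k⁻¹ * inl (φ x (c⁻¹ * l * c)) * k := by
    rw [mul_assoc, eq_inv_mul_iff_mul_eq]
    have hkl : k * inl l = inl (c * φ x (c⁻¹ * l * c)) * inr x * (inl c)⁻¹ := by
      simp [k, mul_assoc, inl_aut]
    rw [hkl, hcomm, map_mul]
    simp only [k, mul_assoc]
  rw [Subgroup.mem_comap, hconj]
  exact mul_mem (mul_mem (inv_mem hk) (hle' (map_mem_factor_twist_inv hl'))) hk

end Dichotomy

theorem inl_range_le_of_dichotomy [Finite G] [Finite X] [IsMulCommutative X] {q : ℕ}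
    (hq : q.Prime) (hxq : φ x ^ q = 1) (hx : x ∉ kerStabilizer φ f)
    (hdich : ∀ z : G, inl z * inr x * (inl z)⁻¹ ∈ H ∨
      ∀ d ∈ fixedSubgroup (φ x), z * d * z⁻¹ ∈ H.comap inl) :
    (inl : G →* G ⋊[φ] X).range ≤ H := by
  by_cases hz : ∃ z : G, ∀ d ∈ fixedSubgroup (φ x), z * d * z⁻¹ ∈ H.comap inl
  · obtain ⟨z, hz⟩ := hz
    let K : Subgroup (G ⋊[φ] X) := H.comap (MulAut.conj (inl z)).toMonoidHom
    have hmem (a : G) : a ∈ K.comap inl ↔ z * a * z⁻¹ ∈ H.comap inl := by simp [K]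
    have hle (y : X) : factor φ (twist φ f y) ≤ K.comap inl := by
      refine (h.twist y).factor_le hT hq hxq (by rwa [kerStabilizer_twist]) (fun d hd => ?_)
        fun t => (hdich (z * t)).imp (fun ht => ?_) fun ht d hd => ?_
      · exact (hmem d).2 (hz d hd)
      · simpa [K, mul_assoc] using ht
      · simpa [hmem, mul_assoc] using ht d hd
    have htop : K.comap inl = ⊤ := top_le_iff.1 (h.iSup_factor_eq_top hT ▸ iSup_le hle)
    refine inl_range_le_iff_comap_inl.2 (eq_top_iff.2 fun a _ => ?_)
    have ha := (hmem (z⁻¹ * a * z)).1 (htop ▸ Subgroup.mem_top _)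
    simpa [mul_assoc] using ha
  · have hx1 : φ x ≠ 1 := fun hx1 => hx (mem_kerStabilizer.2 fun a => by simp [hx1])
    exact h.inl_range_le_of_forall_conj_inr_mem hT hx1 fun z =>
      (hdich z).resolve_right (not_exists.1 hz z)

end IsFaithfulProjection

end ConjugatesOfComplement

section ProductOfSimpleGroups

open SemidirectProduct

variable {X G T : Type*} [Group X] [Group G] [Group T] {φ : X →* MulAut G} {f : G →* T}

theorem conj_inr_mem_of_mem_zpowers {H : Subgroup (G ⋊[φ] X)} {z : G} {x y : X}
    (hxy : x ∈ Subgroup.zpowers y) (hy : inl z * inr y * (inl z)⁻¹ ∈ H) :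
    inl z * inr x * (inl z)⁻¹ ∈ H := by
  obtain ⟨k, rfl⟩ := hxy
  simpa only [conj_zpow, map_zpow] using zpow_mem hy k

/-- The inclusion of the semidirect product of the fixed points of `φ x` with `X`. -/
def fixedInclusion [IsMulCommutative X] (φ : X →* MulAut G) (x : X) :
    fixedSubgroup (φ x) ⋊[fixedAction φ x] X →* G ⋊[φ] X :=
  SemidirectProduct.map (fixedSubgroup (φ x)).subtype (MonoidHom.id X) fun _ => rfl

@[simp]
theorem fixedInclusion_inl [IsMulCommutative X] (x : X) (d : fixedSubgroup (φ x)) :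
    fixedInclusion φ x (inl d) = inl (d : G) :=
  SemidirectProduct.map_inl _ _ _ d

@[simp]
theorem fixedInclusion_inr [IsMulCommutative X] (x y : X) :
    fixedInclusion φ x (inr y) = inr y :=
  SemidirectProduct.map_inr _ _ _ y

theorem exists_fixedAction_eq_one_or_conj_mem [IsMulCommutative X] {x : X}
    (hfixed : ∀ K : Subgroup (fixedSubgroup (φ x) ⋊[fixedAction φ x] X), ¬ inl.range ≤ K →
      ∃ d, ∀ y, inl d * inr y * (inl d)⁻¹ ∈ K → fixedAction φ x y = 1)
    (H : Subgroup (G ⋊[φ] X)) (z : G) :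
    (∃ d ∈ fixedSubgroup (φ x), ∀ y, inl (z * d) * inr y * (inl (z * d))⁻¹ ∈ H →
      fixedAction φ x y = 1) ∨ ∀ d ∈ fixedSubgroup (φ x), z * d * z⁻¹ ∈ H.comap inl := by
  let K := H.comap ((MulAut.conj (inl z)).toMonoidHom.comp (fixedInclusion φ x))
  by_cases hK : inl.range ≤ K
  · refine .inr fun d hd => ?_
    have hdK : inl ⟨d, hd⟩ ∈ K := hK ⟨_, rfl⟩
    simpa [K] using hdK
  · obtain ⟨d, hd⟩ := hfixed K hK
    refine .inl ⟨d, d.2, fun y hy => hd y ?_⟩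
    simpa [K, mul_assoc] using hy

theorem conj_mul_inr_eq_of_mem_fixedSubgroup {x : X} {z d : G} (hd : d ∈ fixedSubgroup (φ x)) :
    (inl (z * d) * inr x * (inl (z * d))⁻¹ : G ⋊[φ] X) = inl z * inr x * (inl z)⁻¹ := by
  have hdx : (inl d * inr x * (inl d)⁻¹ : G ⋊[φ] X) = inr x := by
    rw [mul_inv_eq_iff_eq_mul, ← eq_mul_inv_iff_mul_eq, ← map_inv, ← inl_aut,
      mem_fixedSubgroup.1 hd]
  conv_rhs => rw [← hdx]
  simp only [map_mul, mul_inv_rev, mul_assoc]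

theorem eq_of_mem_kerStabilizer {p q : ℕ} (hp : p.Prime)
    (hstab : ∀ y ∈ kerStabilizer φ f, ∃ n, φ y ^ p ^ n = 1) {x : X}
    (hx : IsPrimaryModulo φ.ker q x) (hxf : x ∈ kerStabilizer φ f) : q = p := by
  by_contra hqp
  obtain ⟨n, hn⟩ := hstab x hxf
  refine hx.notMem (mem_of_pow_mem_of_pow_mem_of_coprime (n := p ^ n)
    (((Nat.coprime_primes hx.prime hp).2 hqp).pow_right n) hx.pow_mem ?_)
  rwa [MonoidHom.mem_ker, map_pow]

namespace IsFaithfulProjection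

variable [Finite X] [IsMulCommutative X] [Finite G] (h : IsFaithfulProjection φ f)
  (hT : IsNonabelianSimple T)
include h hT

theorem exists_fixedAction_pow_eq_one {x : X} {q : ℕ} (hq : q.Prime) (hxq : φ x ^ q = 1)
    (hx : x ∉ kerStabilizer φ f) {p : ℕ} (hstab : ∀ y ∈ kerStabilizer φ f, ∃ n, φ y ^ p ^ n = 1)
    {y : X} (hy : y ∈ kerStabilizer (fixedAction φ x) (f.comp (fixedSubgroup (φ x)).subtype)) :
    ∃ n, fixedAction φ x y ^ p ^ n = 1 := by
  obtain ⟨j, hj⟩ := h.exists_mul_pow_mem_kerStabilizer hT hq hxq hx hy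
  obtain ⟨n, hn⟩ := hstab _ hj
  refine ⟨n, ?_⟩
  simpa [fixedAction_self] using fixedAction_pow_eq_one (x := x) hn

theorem fixedAction_ne_one {x w : X} {q r : ℕ} (hx : IsPrimaryModulo φ.ker q x)
    (hxf : x ∉ kerStabilizer φ f) (hw : IsPrimaryModulo φ.ker r w) (hqr : q ≠ r) :
    fixedAction φ x w ≠ 1 := fun hwx => by
  have hker : φ.ker ≤ kerStabilizer φ f := fun y hy =>
    mem_kerStabilizer.2 fun a => by rw [MonoidHom.mem_ker.1 hy, MulAut.one_apply]
  have hxq : φ x ^ q = 1 := by rw [← map_pow, hx.pow_mem]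
  obtain ⟨j, hj⟩ := h.exists_mul_pow_mem_kerStabilizer hT hx.prime hxq hxf (y := w)
    (mem_kerStabilizer.2 fun a => by rw [hwx, MulAut.one_apply])
  have hwq : w ^ q * (x ^ q) ^ j ∈ kerStabilizer φ f := by
    rw [pow_right_comm, ← Commute.mul_pow (mul_comm' _ _)]
    exact pow_mem hj q
  have hwf : w ∈ kerStabilizer φ f :=
    mem_of_pow_mem_of_pow_mem_of_coprime ((Nat.coprime_primes hx.prime hw.prime).2 hqr)
      ((Subgroup.mul_mem_cancel_right _ (pow_mem (hker hx.pow_mem) j)).1 hwq) (hker hw.pow_mem)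
  exact hw.notMem (h.map_eq_one_of_fixedAction_eq_one hT hx.prime hxq hxf hwf hwx)

end IsFaithfulProjection

theorem IsFaithfulProjection.exists_conj_inr_mem_imp_eq_one {X G T : Type*} [Group X] [Finite X]
    [IsCyclic X] [Group G] [Finite G] [Group T] {φ : X →* MulAut G} {f : G →* T}
    (h : IsFaithfulProjection φ f) (hT : IsNonabelianSimple T) {p : ℕ} (hp : p.Prime)
    (hstab : ∀ y ∈ kerStabilizer φ f, ∃ n, φ y ^ p ^ n = 1) {H : Subgroup (G ⋊[φ] X)}
    (hH : ¬ inl.range ≤ H) : ∃ z : G, ∀ y, inl z * inr y * (inl z)⁻¹ ∈ H → φ y = 1 := by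
  by_contra! hcon
  obtain ⟨ι, _, q, x, hqinj, hx, hcover⟩ := exists_isPrimaryModulo_family φ.ker
  have hconj (z : G) : ∃ i, inl z * inr (x i) * (inl z)⁻¹ ∈ H := by
    obtain ⟨y, hyH, hy⟩ := hcon z
    exact (hcover y hy).imp fun i hi => conj_inr_mem_of_mem_zpowers hi hyH
  by_cases hK : ∀ i, x i ∈ kerStabilizer φ f
  · have : Subsingleton ι := ⟨fun i j => hqinj <|
      (eq_of_mem_kerStabilizer hp hstab (hx i) (hK i)).trans
        (eq_of_mem_kerStabilizer hp hstab (hx j) (hK j)).symm⟩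
    obtain ⟨i, -⟩ := hconj 1
    refine hH (h.inl_range_le_of_forall_conj_inr_mem hT (hx i).notMem fun z => ?_)
    obtain ⟨j, hj⟩ := hconj z
    rwa [Subsingleton.elim i j]
  · obtain ⟨i, hi⟩ := not_forall.1 hK
    have hxq : φ (x i) ^ q i = 1 := by rw [← map_pow, (hx i).pow_mem]
    refine hH (h.inl_range_le_of_dichotomy hT (hx i).prime hxq hi fun z => ?_)
    rcases exists_fixedAction_eq_one_or_conj_mem (φ := φ) (x := x i) (fun K hK =>
      (h.fixedAction hT (hx i).prime hxq hi).exists_conj_inr_mem_imp_eq_one hT hp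
        (fun y => h.exists_fixedAction_pow_eq_one hT (hx i).prime hxq hi hstab) hK) H z with
      ⟨d, hd, hdy⟩ | hz
    · obtain ⟨j, hj⟩ := hconj (z * d)
      obtain rfl : i = j := by
        by_contra hij
        exact h.fixedAction_ne_one hT (hx i) hi (hx j) (hqinj.ne hij) (hdy _ hj)
      exact .inl (conj_mul_inr_eq_of_mem_fixedSubgroup hd ▸ hj)
    · exact .inr hz
termination_by Nat.card G
decreasing_by exact card_fixedSubgroup_lt (hx i).notMem

end ProductOfSimpleGroups

section CosetAvoidance

variable {U ι : Type*} [Group U] [Finite ι]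

theorem exists_forall_mul_notMem_of_card_lt {V W : Subgroup U} {Z : ι → Subgroup U}
    (hZ : ∀ i, Z i ⊓ W = V) (hcard : Nat.card ι < V.relIndex W) (a : ι → U) :
    ∃ c ∈ W, ∀ i, a i * c ∉ Z i := by
  by_contra! hcon
  have hcover (d : W ⧸ V.subgroupOf W) : ∃ i, a i * d.out ∈ Z i := hcon _ d.out.2
  choose i hi using hcover
  refine hcard.not_ge (Nat.card_le_card_of_injective i fun d e hde => ?_)
  have hmem : (a (i d) * d.out)⁻¹ * (a (i d) * e.out) ∈ Z (i d) :=
    mul_mem (inv_mem (hi d)) (hde ▸ hi e)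
  have hV : (↑(d.out⁻¹ * e.out) : U) ∈ V :=
    (hZ (i d)).le (Subgroup.mem_inf.2 ⟨by simpa [mul_assoc] using hmem, (d.out⁻¹ * e.out).2⟩)
  rw [← d.out_eq', ← e.out_eq', QuotientGroup.eq]
  exact hV

/-- Descending from `U` to `⊥` through the subgroups satisfying `P`, each step only has to avoid the
cosets of those `Z i` that the step separates. -/
theorem exists_forall_inv_mul_notMem [Finite U] {P : Subgroup U → Prop} (htop : P ⊤) (hbot : P ⊥)
    (hinf : ∀ V W, P V → P W → P (V ⊓ W)) {Z : ι → Subgroup U} (hZ : ∀ i, P (Z i))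
    (hZtop : ∀ i, Z i ≠ ⊤)
    (hcard : ∀ V W, P V → P W → V < W → Nat.card {i // Z i ⊓ W = V} < V.relIndex W)
    (u : ι → U) : ∃ v, ∀ i, (u i)⁻¹ * v ∉ Z i := by
  suffices h : ∀ V, P V → ∃ v, ∀ i, V ≤ Z i → (u i)⁻¹ * v ∉ Z i by
    obtain ⟨v, hv⟩ := h ⊥ hbot
    exact ⟨v, fun i => hv i bot_le⟩
  intro V hV
  induction V using WellFoundedGT.induction with | ind V ih =>
  rcases eq_or_ne V ⊤ with rfl | hVtop
  · exact ⟨1, fun i hi => (hZtop i (top_le_iff.1 hi)).elim⟩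
  obtain ⟨W, ⟨hW, hVW⟩, hmin⟩ := exists_minimal_of_wellFoundedLT
    (fun W => P W ∧ V < W) ⟨⊤, htop, hVtop.lt_top⟩
  obtain ⟨w, hw⟩ := ih W hVW hW
  obtain ⟨c, hc, hcZ⟩ := exists_forall_mul_notMem_of_card_lt
    (Z := fun i : {i // Z i ⊓ W = V} => Z i) Subtype.prop (hcard V W hV hW hVW)
    fun i => (u i)⁻¹ * w
  refine ⟨w * c, fun i hi hmem => ?_⟩
  rw [← mul_assoc] at hmem
  by_cases hWi : W ≤ Z i
  · exact hw i hWi ((Subgroup.mul_mem_cancel_right _ (hWi hc)).1 hmem)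
  · have hVi : ¬ V < Z i ⊓ W := fun hlt =>
      hWi ((hmin ⟨hinf _ _ (hZ i) hW, hlt⟩ inf_le_right).trans inf_le_left)
    exact hcZ ⟨i, ((le_inf hi hVW.le).eq_of_not_lt hVi).symm⟩ hmem

omit [Finite ι] in
theorem card_lt_of_injective_of_prime {q : ι → ℕ} (hq : q.Injective) {l m : ℕ} (hm : 1 < m)
    (hprime : ∀ i, (q i).Prime) (hlt : ∀ i, q i ≠ l → q i < m) : Nat.card ι < m := by
  classical
  let e (i : ι) : Fin (m - 1) := if h : q i = l then ⟨0, by omega⟩ else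
    ⟨q i - 1, by have := hlt i h; have := (hprime i).pos; omega⟩
  have he : e.Injective := fun i j hij => hq <| by
    have := (hprime i).two_le
    have := (hprime j).two_le
    simp only [e] at hij
    split_ifs at hij <;> rw [Fin.ext_iff] at hij <;> dsimp only at hij <;> omega
  have := Nat.card_le_card_of_injective e he
  rw [Nat.card_fin] at this
  omega

end CosetAvoidance

section FixedPointsOfCommutingAutomorphisms

variable {U : Type*} [Group U] [Finite U]

theorem card_modEq_card_fixedSubgroup_inf {σ : MulAut U} {q k : ℕ} (hq : q.Prime)
    (hσ : σ ^ q ^ k = 1) {W : Subgroup U} (hW : ∀ a ∈ W, σ a ∈ W) :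
    Nat.card W ≡ Nat.card (fixedSubgroup σ ⊓ W : Subgroup U) [MOD q] := by
  classical
  have := Fintype.ofFinite W
  have := Fact.mk hq
  let s : Function.End W := fun a => ⟨σ a, hW a a.2⟩
  have hs (n : ℕ) (a : W) : ((s ^ n) a : U) = (σ ^ n) a := by
    induction n with
    | zero => rfl
    | succ n ih => rw [pow_succ', pow_succ', MulAut.mul_apply, ← ih]; rfl
  have hmod := Equiv.Perm.card_fixedPoints_modEq (f := s) (p := q) (n := k)
    (funext fun a => Subtype.ext (by rw [hs, hσ]; rfl))
  rw [← Nat.card_eq_fintype_card, ← Nat.card_eq_fintype_card] at hmod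
  let e : s.fixedPoints ≃ (fixedSubgroup σ ⊓ W : Subgroup U) :=
    { toFun a := ⟨a, Subgroup.mem_inf.2 ⟨congrArg Subtype.val a.2, a.1.2⟩⟩
      invFun a := ⟨⟨a, a.2.2⟩, Subtype.ext a.2.1⟩ }
  rwa [Nat.card_congr e] at hmod

theorem one_lt_relIndex {V W : Subgroup U} (hVW : V < W) : 1 < V.relIndex W := by
  have hne : V.relIndex W ≠ 1 := fun h => hVW.not_ge (Subgroup.relIndex_eq_one.1 h)
  have hpos : V.relIndex W ≠ 0 := Subgroup.index_ne_zero_of_finite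
  omega

theorem lt_relIndex_of_fixedSubgroup_inf_eq {l : ℕ} (hl : l.Prime) (hU : IsPGroup l U)
    {σ : MulAut U} {q k : ℕ} (hq : q.Prime) (hql : q ≠ l) (hσ : σ ^ q ^ k = 1) {V W : Subgroup U}
    (hW : ∀ a ∈ W, σ a ∈ W) (hVW : V < W) (hV : fixedSubgroup σ ⊓ W = V) : q < V.relIndex W := by
  have hmod := card_modEq_card_fixedSubgroup_inf hq hσ hW
  have := Fact.mk hl
  obtain ⟨n, hn⟩ := (hU.to_subgroup V).exists_card_eq
  have hmul := Subgroup.relIndex_mul_relIndex ⊥ V W bot_le hVW.le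
  rw [Subgroup.relIndex_bot_left, Subgroup.relIndex_bot_left, hn] at hmul
  rw [hV, ← hmul, hn, mul_comm] at hmod
  have hone : V.relIndex W ≡ 1 [MOD q] := by
    refine Nat.ModEq.cancel_right_of_coprime (c := l ^ n) ?_ (by rwa [one_mul])
    exact ((Nat.coprime_primes hq hl).2 hql).pow_right n
  have hlt := one_lt_relIndex hVW
  have := Nat.le_of_dvd (by omega) ((Nat.modEq_iff_dvd' hlt.le).1 hone.symm)
  omega

theorem exists_forall_inv_mul_notMem_fixedSubgroup {l : ℕ} (hl : l.Prime) (hU : IsPGroup l U)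
    {ι : Type*} [Finite ι] {σ : ι → MulAut U} (hcomm : ∀ i j, Commute (σ i) (σ j))
    (hσ : ∀ i, σ i ≠ 1) {q : ι → ℕ} (hqinj : q.Injective) (hq : ∀ i, (q i).Prime)
    (hpow : ∀ i, ∃ k, σ i ^ q i ^ k = 1) (u : ι → U) :
    ∃ v, ∀ i, (u i)⁻¹ * v ∉ fixedSubgroup (σ i) := by
  refine exists_forall_inv_mul_notMem (P := fun V => ∀ i, ∀ a ∈ V, σ i a ∈ V)
    (fun i a _ => Subgroup.mem_top _) (fun i a ha => ?_) (fun V W hV hW i a ha => ?_)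
    (fun j i a ha => ?_) (fun i htop => ?_) (fun V W _ hW hVW => ?_) u
  · rw [Subgroup.mem_bot.1 ha, map_one]
    exact one_mem _
  · exact Subgroup.mem_inf.2 ⟨hV i a ha.1, hW i a ha.2⟩
  · rw [mem_fixedSubgroup, ← MulAut.mul_apply, (hcomm j i).eq, MulAut.mul_apply,
      mem_fixedSubgroup.1 ha]
  · exact hσ i (MulEquiv.ext fun a => mem_fixedSubgroup.1 (htop ▸ Subgroup.mem_top a))
  · refine card_lt_of_injective_of_prime (l := l) (hqinj.comp Subtype.val_injective)
      (one_lt_relIndex hVW) (fun i => hq i) fun i hi => ?_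
    obtain ⟨k, hk⟩ := hpow i
    exact lt_relIndex_of_fixedSubgroup_inf_eq hl hU (hq i) hi hk (hW i) hVW i.2

end FixedPointsOfCommutingAutomorphisms

section SolubleNormalSubgroup

/-- The action on `N ⧸ M` of the automorphisms of `N` that leave the normal subgroup `M`
invariant. -/
def stabilizerQuotientAut {N : Type*} [Group N] (M : Subgroup N) [M.Normal] :
    MulAction.stabilizer (MulAut N) M →* MulAut (N ⧸ M) where
  toFun σ := QuotientGroup.congr M M σ σ.2
  map_one' := by
    ext a
    induction a using QuotientGroup.induction_on
    rfl
  map_mul' σ τ := by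
    ext a
    induction a using QuotientGroup.induction_on
    rfl

theorem mem_fixedSubgroup_stabilizerQuotientAut {N : Type*} [Group N] {M : Subgroup N} [M.Normal]
    {σ : MulAction.stabilizer (MulAut N) M} {a : N} :
    (a : N ⧸ M) ∈ fixedSubgroup (stabilizerQuotientAut M σ) ↔ a * ((σ : MulAut N) a)⁻¹ ∈ M := by
  rw [mem_fixedSubgroup, eq_comm, ← mul_inv_eq_one, ← QuotientGroup.eq_one_iff]
  rfl

variable {A : Type*} [Group A] {N H : Subgroup A} [N.Normal] [(H.subgroupOf N).Normal]

theorem conjNormal_mem_stabilizer_subgroupOf {u : N} {x : A} (hx : u * x * (u : A)⁻¹ ∈ H) :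
    MulAut.conjNormal x ∈ MulAction.stabilizer (MulAut N) (H.subgroupOf N) := by
  have hu : MulAut.conjNormal (u : A) ∈ MulAction.stabilizer (MulAut N) (H.subgroupOf N) := by
    rw [MulAut.conjNormal_val]
    exact Subgroup.Normal.conj_smul_eq_self u _
  have hH {h : A} (hh : h ∈ H) :
      MulAut.conjNormal h ∈ MulAction.stabilizer (MulAut N) (H.subgroupOf N) := by
    ext a
    rw [Subgroup.mem_pointwise_smul_iff_inv_smul_mem, Subgroup.mem_subgroupOf, MulAut.smul_def,
      MulAut.conjNormal_inv_apply, Subgroup.mul_mem_cancel_right _ hh,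
      Subgroup.mul_mem_cancel_left _ (inv_mem hh), Subgroup.mem_subgroupOf]
  have hconj := mul_mem (mul_mem (inv_mem hu) (hH hx)) hu
  rwa [← map_inv, ← map_mul, ← map_mul, mul_assoc, inv_mul_cancel_right,
    inv_mul_cancel_left] at hconj

theorem conj_mem_iff_mem_fixedSubgroup {u v : N} {x : A} (hx : u * x * (u : A)⁻¹ ∈ H)
    (hσ : MulAut.conjNormal x ∈ MulAction.stabilizer (MulAut N) (H.subgroupOf N)) :
    v * x * (v : A)⁻¹ ∈ H ↔ (u : N ⧸ H.subgroupOf N)⁻¹ * v ∈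
      fixedSubgroup (stabilizerQuotientAut (H.subgroupOf N) ⟨_, hσ⟩) := by
  have hmul : ((v * (MulAut.conjNormal x (u⁻¹ * v))⁻¹ * u⁻¹ : N) : A) =
      v * x * (v : A)⁻¹ * (u * x * (u : A)⁻¹)⁻¹ := by
    simp [mul_assoc]
  have hrotate : u⁻¹ * v * (MulAut.conjNormal x (u⁻¹ * v))⁻¹ ∈ H.subgroupOf N ↔
      v * (MulAut.conjNormal x (u⁻¹ * v))⁻¹ * u⁻¹ ∈ H.subgroupOf N := by
    rw [mul_assoc]
    exact (inferInstance : (H.subgroupOf N).Normal).mem_comm_iff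
  rw [← QuotientGroup.mk_inv, ← QuotientGroup.mk_mul, mem_fixedSubgroup_stabilizerQuotientAut,
    hrotate, Subgroup.mem_subgroupOf, hmul, Subgroup.mul_mem_cancel_right _ (inv_mem hx)]

theorem exists_forall_conj_notMem_of_isPGroup_quotient [Finite N] {l : ℕ} (hl : l.Prime)
    (hN : IsPGroup l (N ⧸ H.subgroupOf N)) {ι : Type*} [Finite ι] {x : ι → A}
    (hcomm : ∀ i j, Commute (x i) (x j)) {q : ι → ℕ} (hqinj : q.Injective)
    (hq : ∀ i, (q i).Prime) (hpow : ∀ i, ∃ k, x i ^ q i ^ k = 1)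
    (hmove : ∀ i, ∃ n : N, n * x i * (n : A)⁻¹ ∉ H) :
    ∃ v : N, ∀ i, v * x i * (v : A)⁻¹ ∉ H := by
  let κ := {i // ∃ u : N, u * x i * (u : A)⁻¹ ∈ H}
  choose u hu using fun i : κ => i.2
  have hmem (i : κ) := conjNormal_mem_stabilizer_subgroupOf (hu i)
  let σ (i : κ) := stabilizerQuotientAut (H.subgroupOf N) ⟨_, hmem i⟩
  have hσcomm (i j : κ) : Commute (σ i) (σ j) :=
    Commute.map (Subtype.ext ((hcomm i j).map MulAut.conjNormal).eq :
      Commute (⟨_, hmem i⟩ : MulAction.stabilizer (MulAut N) (H.subgroupOf N)) ⟨_, hmem j⟩) _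
  have hσ (i : κ) : σ i ≠ 1 := by
    intro hi
    obtain ⟨n, hn⟩ := hmove i
    exact hn ((conj_mem_iff_mem_fixedSubgroup (hu i) (hmem i)).2
      (mem_fixedSubgroup.2 (DFunLike.congr_fun hi _)))
  have hσpow (i : κ) : ∃ k, σ i ^ q i ^ k = 1 := by
    obtain ⟨k, hk⟩ := hpow i
    refine ⟨k, ?_⟩
    have hpow_eq_one : (⟨_, hmem i⟩ : MulAction.stabilizer (MulAut N) (H.subgroupOf N)) ^
        q i ^ k = 1 :=
      Subtype.ext ((map_pow MulAut.conjNormal _ _).symm.trans (by rw [hk, map_one]; rfl))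
    rw [← map_pow, hpow_eq_one, map_one]
  obtain ⟨v, hv⟩ := exists_forall_inv_mul_notMem_fixedSubgroup hl hN hσcomm hσ
    (hqinj.comp Subtype.val_injective) (fun i => hq i) hσpow fun i => u i
  obtain ⟨v, rfl⟩ := QuotientGroup.mk_surjective v
  refine ⟨v, fun i hi => hv ⟨i, v, hi⟩ ?_⟩
  exact (conj_mem_iff_mem_fixedSubgroup (hu ⟨i, v, hi⟩) _).1 hi

end SolubleNormalSubgroup

section SolubleReduction

theorem isPGroup_of_closure_eq_top {Q : Type*} [Group Q] [IsMulCommutative Q] {l : ℕ} {s : Set Q}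
    (hs : Subgroup.closure s = ⊤) (hpow : ∀ a ∈ s, ∃ k, a ^ l ^ k = 1) : IsPGroup l Q := by
  intro a
  induction hs ▸ Subgroup.mem_top a using Subgroup.closure_induction with
  | mem a ha => exact hpow a ha
  | one => exact ⟨0, one_pow _⟩
  | inv a _ ha => simpa only [inv_pow, inv_eq_one] using ha
  | mul a b _ _ ha hb =>
    obtain ⟨m, hm⟩ := ha
    obtain ⟨n, hn⟩ := hb
    refine ⟨m + n, ?_⟩
    have hab : Commute a b := mul_comm' a b
    rw [hab.mul_pow, pow_add, pow_mul, hm, one_pow, mul_comm (l ^ m),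
      pow_mul, hn, one_pow, one_mul]

theorem closure_characteristic {N : Type*} [Group N] {s : Set N}
    (hs : ∀ σ : MulAut N, ∀ a ∈ s, σ a ∈ s) : (Subgroup.closure s).Characteristic := by
  rw [Subgroup.characteristic_iff_map_le]
  intro σ
  rw [MonoidHom.map_closure]
  exact Subgroup.closure_mono (Set.image_subset_iff.2 (hs σ))

variable {A : Type*} [Group A] {H R N : Subgroup A}

theorem characteristic_le_subgroupOf_of_minimal
    (hmin : Minimal (fun N : Subgroup A => N.Normal ∧ N ≤ R ∧ ¬ N ≤ H) N) {W : Subgroup N}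
    [W.Characteristic] (hW : W ≠ ⊤) : W ≤ H.subgroupOf N := by
  have := hmin.prop.1
  by_contra hWH
  have hle : N ≤ W.map N.subtype := hmin.le_of_le
    ⟨inferInstance, (Subgroup.map_subtype_le W).trans hmin.prop.2.1,
      mt Subgroup.map_le_iff_le_comap.1 hWH⟩
    (Subgroup.map_subtype_le W)
  exact hW (eq_top_iff.2 fun n _ => (Subgroup.mem_map_iff_mem N.subtype_injective).1 (hle n.2))

theorem commutator_le_subgroupOf_of_minimal [Group.IsSolvable N]
    (hmin : Minimal (fun N : Subgroup A => N.Normal ∧ N ≤ R ∧ ¬ N ≤ H) N) :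
    commutator N ≤ H.subgroupOf N := by
  have : Nontrivial N :=
    N.nontrivial_iff_ne_bot.2 fun h => hmin.prop.2.2 (h ▸ bot_le)
  exact characteristic_le_subgroupOf_of_minimal hmin
    (Group.IsSolvable.commutator_lt_top_of_nontrivial N).ne

theorem exists_prime_isPGroup_quotient_of_minimal [Finite N] [(H.subgroupOf N).Normal]
    (hmin : Minimal (fun N : Subgroup A => N.Normal ∧ N ≤ R ∧ ¬ N ≤ H) N)
    (hcomm : commutator N ≤ H.subgroupOf N) :
    ∃ l, l.Prime ∧ IsPGroup l (N ⧸ H.subgroupOf N) := by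
  have := Subgroup.Normal.quotient_commutative_iff_commutator_le.2 hcomm
  obtain ⟨y, hyN, hyH⟩ := SetLike.not_le_iff_exists.1 hmin.prop.2.2
  obtain ⟨l, w, -, hw⟩ :=
    exists_isPrimaryModulo_mem_zpowers (C := H.subgroupOf N) (y := ⟨y, hyN⟩) hyH
  let s : Set N := {a | ∃ k, a ^ l ^ k = 1}
  have hchar : (Subgroup.closure s).Characteristic := closure_characteristic fun σ a ⟨k, hk⟩ =>
    ⟨k, by rw [← map_pow, hk, map_one]⟩
  have hs : Subgroup.closure s = ⊤ := by
    by_contra hne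
    exact hw.notMem (characteristic_le_subgroupOf_of_minimal hmin hne
      (Subgroup.subset_closure hw.exists_pow_eq_one))
  refine ⟨l, hw.prime, isPGroup_of_closure_eq_top (s := QuotientGroup.mk' _ '' s) ?_ ?_⟩
  · rw [← MonoidHom.map_closure, hs, Subgroup.map_top_of_surjective _
      (QuotientGroup.mk'_surjective _)]
  · rintro _ ⟨a, ⟨k, hk⟩, rfl⟩
    exact ⟨k, by rw [← map_pow, hk, map_one]⟩

theorem exists_forall_conj_notMem_of_le_sup_isSolvable [Finite A] {G : Subgroup A} [R.Normal]
    [Group.IsSolvable R] (hRG : R ≤ G) (hHR : G ≤ H ⊔ R) (hH : ¬ G ≤ H) {ι : Type*} [Finite ι]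
    {x : ι → A} (hcomm : ∀ i j, Commute (x i) (x j)) {q : ι → ℕ} (hqinj : q.Injective)
    (hq : ∀ i, (q i).Prime) (hpow : ∀ i, ∃ k, x i ^ q i ^ k = 1)
    (hmove : ∀ K : Subgroup A, ¬ G ≤ K → ∀ i, ∃ z ∈ G, z * x i * z⁻¹ ∉ K) :
    ∃ z ∈ G, ∀ i, z * x i * z⁻¹ ∉ H := by
  obtain ⟨K, hHK, hK⟩ := Finite.exists_le_maximal (p := fun K : Subgroup A => ¬ G ≤ K) hH
  have hRK : ¬ R ≤ K := fun h => hK.prop (hHR.trans (sup_le hHK h))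
  obtain ⟨N, hN⟩ := exists_minimal_of_wellFoundedLT
    (fun N : Subgroup A => N.Normal ∧ N ≤ R ∧ ¬ N ≤ K) ⟨R, inferInstance, le_rfl, hRK⟩
  obtain ⟨hNnormal, hNR, hNK⟩ := hN.prop
  have hNsol : Group.IsSolvable N :=
    Group.isSolvable_of_isSolvable_injective (Subgroup.inclusion_injective hNR)
  have hcommutator := commutator_le_subgroupOf_of_minimal hN
  have hKN : (K.subgroupOf N).Normal :=
    Subgroup.Normal.of_commutator_le _ hcommutator
  obtain ⟨l, hl, hquot⟩ := exists_prime_isPGroup_quotient_of_minimal hN hcommutator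
  have hsup : G ≤ K ⊔ N := by
    by_contra h
    exact hNK (le_sup_right.trans (hK.le_of_ge h le_sup_left))
  have hmoveN (i : ι) : ∃ n : N, n * x i * (n : A)⁻¹ ∉ K := by
    obtain ⟨z, hz, hzK⟩ := hmove K hK.prop i
    obtain ⟨h, hh, n, hn, rfl⟩ := Subgroup.mem_sup_of_normal_right.1 (hsup hz)
    refine ⟨⟨n, hn⟩, fun hnK => hzK ?_⟩
    simpa [mul_assoc] using mul_mem (mul_mem hh hnK) (inv_mem hh)
  obtain ⟨v, hv⟩ :=
    exists_forall_conj_notMem_of_isPGroup_quotient hl hquot hcomm hqinj hq hpow hmoveN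
  exact ⟨v, hRG (hNR v.2), fun i hi => hv i (hHK hi)⟩

end SolubleReduction

section SolubleRadical

theorem isSolvable_of_isSolvable_map {G G' : Type*} [Group G] [Group G'] (f : G →* G')
    [Group.IsSolvable f.ker] {K : Subgroup G} [Group.IsSolvable (K.map f)] :
    Group.IsSolvable K := by
  have hker : Group.IsSolvable (f.ker ⊓ K : Subgroup G) :=
    Group.isSolvable_of_isSolvable_injective
      (Subgroup.inclusion_injective (inf_le_left : f.ker ⊓ K ≤ f.ker))
  refine Group.isSolvable_of_ker_le_range
    (Subgroup.inclusion (inf_le_right : f.ker ⊓ K ≤ K)) (f.subgroupMap K) fun a ha => ?_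
  have hfa : f a = 1 := congrArg Subtype.val (MonoidHom.mem_ker.1 ha)
  exact ⟨⟨a, hfa, a.2⟩, rfl⟩

theorem isSolvable_sup {G : Type*} [Group G] {M N : Subgroup G} [M.Normal] [Group.IsSolvable M]
    [Group.IsSolvable N] : Group.IsSolvable (M ⊔ N : Subgroup G) := by
  have hker : Group.IsSolvable (QuotientGroup.mk' M).ker := by
    rwa [QuotientGroup.ker_mk']
  have hmap : Group.IsSolvable ((M ⊔ N).map (QuotientGroup.mk' M)) := by
    rw [Subgroup.map_sup, QuotientGroup.map_mk'_self, bot_sup_eq]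
    exact Group.isSolvable_of_surjective ((QuotientGroup.mk' M).subgroupMap_surjective N)
  exact isSolvable_of_isSolvable_map (QuotientGroup.mk' M)

instance isSolvable_solubleRadical (G : Type*) [Group G] [Finite G] :
    Group.IsSolvable (solubleRadical G) := by
  obtain ⟨M, hM⟩ := exists_maximal_of_wellFoundedGT
    (fun N : Subgroup G => N.Normal ∧ Group.IsSolvable N) ⟨⊥, inferInstance, inferInstance⟩
  obtain ⟨_, hMsol⟩ := hM.prop
  have heq : solubleRadical G = M := by
    refine le_antisymm (sSup_le fun N ⟨_, _⟩ => ?_) (le_sSup hM.prop)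
    exact le_sup_right.trans (hM.le_of_ge ⟨inferInstance, isSolvable_sup⟩ le_sup_left)
  rwa [heq]

theorem center_quotient_solubleRadical (G : Type*) [Group G] [Finite G] :
    Subgroup.center (G ⧸ solubleRadical G) = ⊥ := by
  set π := QuotientGroup.mk' (solubleRadical G)
  have hker : Group.IsSolvable π.ker := by
    rw [QuotientGroup.ker_mk']
    infer_instance
  have hmap : Group.IsSolvable (((Subgroup.center (G ⧸ solubleRadical G)).comap π).map π) := by
    rw [Subgroup.map_comap_eq_self_of_surjective (QuotientGroup.mk'_surjective _)]
    exact Group.isSolvable_of_comm mul_comm'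
  have hle : (Subgroup.center (G ⧸ solubleRadical G)).comap π ≤ solubleRadical G :=
    le_sSup ⟨inferInstance, isSolvable_of_isSolvable_map π⟩
  rw [← Subgroup.map_comap_eq_self_of_surjective (QuotientGroup.mk'_surjective _)
    (Subgroup.center _), Subgroup.map_eq_bot_iff, QuotientGroup.ker_mk']
  exact hle

end SolubleRadical

section InternalDirectProducts

theorem IsNonabelianSimple.of_mulEquiv {S T : Type*} [Group S] [Group T]
    (hS : IsNonabelianSimple S) (e : S ≃* T) : IsNonabelianSimple T := by
  have := hS.1
  obtain ⟨a, b, hab⟩ := hS.2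
  exact ⟨e.symm.isSimpleGroup, e a, e b, by simpa only [← map_mul, ne_eq, e.injective.eq_iff]⟩

theorem IsNonabelianSimple.not_isMulCommutative {S : Type*} [Group S]
    (hS : IsNonabelianSimple S) : ¬ IsMulCommutative S := fun _ =>
  let ⟨a, b, hab⟩ := hS.2
  hab (mul_comm' a b)

namespace IsInternalDirectProduct

variable {Q ι : Type*} [Group Q] {S : ι → Subgroup Q} (h : IsInternalDirectProduct S)
include h

theorem le_centralizer {i j : ι} (hij : i ≠ j) :
    S j ≤ Subgroup.centralizer (S i : Set Q) := fun b hb a ha =>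
  Subgroup.commute_of_normal_of_disjoint _ _ (h.normal i) (h.normal j)
    (h.independent.pairwiseDisjoint hij) a b ha hb

theorem sup_centralizer_eq_top (i : ι) : S i ⊔ Subgroup.centralizer (S i : Set Q) = ⊤ := by
  rw [eq_top_iff, ← h.iSup_eq_top]
  refine iSup_le fun j => ?_
  by_cases hij : i = j
  · exact hij ▸ le_sup_left
  · exact (h.le_centralizer hij).trans le_sup_right

theorem iInf_centralizer_eq_center :
    ⨅ i, Subgroup.centralizer (S i : Set Q) = Subgroup.center Q := by
  refine le_antisymm (fun a ha => ?_) (le_iInf fun i => Subgroup.center_le_centralizer _)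
  have hle : ⨆ i, S i ≤ Subgroup.centralizer {a} := iSup_le fun i b hb =>
    Subgroup.mem_centralizer_singleton_iff.2 (Subgroup.mem_iInf.1 ha i b hb)
  exact Subgroup.mem_center_iff.2 fun b => Subgroup.mem_centralizer_singleton_iff.1
    (hle (h.iSup_eq_top ▸ Subgroup.mem_top b))

theorem isNonabelianSimple_quotient_centralizer {i : ι} [(S i).Normal]
    (hS : IsNonabelianSimple (S i)) :
    IsNonabelianSimple (Q ⧸ Subgroup.centralizer (S i : Set Q)) := by
  let e := (QuotientGroup.mk' (Subgroup.centralizer (S i : Set Q))).comp (S i).subtype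
  have hinj : Function.Injective e := by
    refine (MonoidHom.ker_eq_bot_iff e).1 (eq_bot_iff.2 (hS.center_eq_bot ▸ fun s hs => ?_))
    have hsC : (s : Q) ∈ Subgroup.centralizer (S i : Set Q) := (QuotientGroup.eq_one_iff _).1 hs
    exact Subgroup.mem_center_iff.2 fun u => Subtype.ext (hsC u u.2)
  have hsurj : Function.Surjective e := by
    rw [← MonoidHom.range_eq_top, MonoidHom.range_comp, Subgroup.range_subtype]
    have hmap := congrArg (Subgroup.map (QuotientGroup.mk' (Subgroup.centralizer (S i : Set Q))))
      (h.sup_centralizer_eq_top i)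
    rwa [Subgroup.map_sup, QuotientGroup.map_mk'_self, sup_bot_eq, Subgroup.map_top_of_surjective _
      (QuotientGroup.mk'_surjective _)] at hmap
  exact hS.of_mulEquiv (MulEquiv.ofBijective e ⟨hinj, hsurj⟩)

theorem smul_eq_of_smul_centralizer_eq {σ : MulAut Q} {i : ι} (hS : ¬ IsMulCommutative (S i))
    (hσ : σ • Subgroup.centralizer (S i : Set Q) = Subgroup.centralizer (S i : Set Q))
    (hrange : σ • S i ∈ Set.range S) : σ • S i = S i := by
  obtain ⟨j, hj⟩ := hrange
  by_contra hne
  have hij : i ≠ j := fun hij => hne (hij ▸ hj.symm)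
  have hle := h.le_centralizer hij
  rw [hj, ← hσ, Subgroup.pointwise_smul_le_pointwise_smul_iff] at hle
  exact hS (Subgroup.le_centralizer_iff_isMulCommutative.1 hle)

theorem smul_eq_of_mem_kerStabilizer {X : Type*} [Group X] {φ : X →* MulAut Q} {i : ι}
    [(S i).Normal] (hS : ¬ IsMulCommutative (S i)) {y : X}
    (hy : y ∈ kerStabilizer φ (QuotientGroup.mk' (Subgroup.centralizer (S i : Set Q))))
    (hrange : φ y • S i ∈ Set.range S) : φ y • S i = S i := by
  rw [kerStabilizer, QuotientGroup.ker_mk'] at hy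
  exact h.smul_eq_of_smul_centralizer_eq hS hy hrange

theorem isFaithfulProjection {X : Type*} [Group X] {φ : X →* MulAut Q}
    (hcenter : Subgroup.center Q = ⊥) {i₀ : ι} [(S i₀).Normal]
    (htrans : ∀ i, ∃ y, φ y • S i₀ = S i) :
    IsFaithfulProjection φ (QuotientGroup.mk' (Subgroup.centralizer (S i₀ : Set Q))) where
  surjective := QuotientGroup.mk'_surjective _
  iInf_ker_eq_bot := by
    rw [eq_bot_iff, ← hcenter, ← h.iInf_centralizer_eq_center]
    refine le_iInf fun i a ha b hb => ?_
    obtain ⟨y, hy⟩ := htrans i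
    rw [SetLike.mem_coe, ← hy, Subgroup.mem_pointwise_smul_iff_inv_smul_mem, ← map_inv] at hb
    have hay : φ y⁻¹ a ∈ Subgroup.centralizer (S i₀ : Set Q) :=
      (QuotientGroup.eq_one_iff _).1 (Subgroup.mem_iInf.1 ha y⁻¹)
    refine (φ y⁻¹).injective ?_
    rw [map_mul, map_mul]
    exact hay _ hb

end IsInternalDirectProduct

end InternalDirectProducts

section ConjugatesModuloKernel

open SemidirectProduct

theorem exists_conj_mem_imp_eq_one_of_not_le_sup {A Q T : Type*} [Group A] [Group Q] [Finite Q]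
    [Group T] {G X : Subgroup A} [G.Normal] [Finite X] [IsCyclic X] {φ : A →* MulAut Q}
    {π : G →* Q} (hπ : Function.Surjective π)
    (hφ : ∀ x a, π (MulAut.conjNormal x a) = φ x (π a)) {f : Q →* T}
    (hf : IsFaithfulProjection (φ.comp X.subtype) f) (hT : IsNonabelianSimple T) {p : ℕ}
    (hp : p.Prime)
    (hstab : ∀ y ∈ kerStabilizer (φ.comp X.subtype) f, ∃ n, φ.comp X.subtype y ^ p ^ n = 1)
    {H : Subgroup A} (hH : ¬ G ≤ H ⊔ π.ker.map G.subtype) :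
    ∃ z ∈ G, ∀ y ∈ X, z * y * z⁻¹ ∈ H → φ y = 1 := by
  let α : G ⋊[MulAut.conjNormal.comp X.subtype] X →* A :=
    SemidirectProduct.lift G.subtype X.subtype fun x => by ext a; simp
  let β : G ⋊[MulAut.conjNormal.comp X.subtype] X →* Q ⋊[φ.comp X.subtype] X :=
    SemidirectProduct.map π (.id X) fun x => by ext a; simp [hφ]
  have hβ : ¬ inl.range ≤ (H.comap α).map β := by
    refine fun hle => hH fun a ha => ?_
    obtain ⟨s, hs, hsa⟩ := hle ⟨π ⟨a, ha⟩, rfl⟩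
    have hright : s.right = 1 := congrArg SemidirectProduct.right hsa
    have hleft : π s.left = π ⟨a, ha⟩ := congrArg SemidirectProduct.left hsa
    have hsH : (s.left : A) ∈ H := by
      simpa [α, SemidirectProduct.lift, hright] using Subgroup.mem_comap.1 hs
    have hker : s.left⁻¹ * ⟨a, ha⟩ ∈ π.ker := by
      rw [MonoidHom.mem_ker, map_mul, map_inv, hleft, inv_mul_cancel]
    simpa using Subgroup.mul_mem_sup hsH (Subgroup.mem_map_of_mem G.subtype hker)
  obtain ⟨z, hz⟩ := hf.exists_conj_inr_mem_imp_eq_one hT hp hstab hβ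
  obtain ⟨z, rfl⟩ := hπ z
  refine ⟨z, z.2, fun y hy hyH => hz ⟨y, hy⟩ ⟨inl z * inr ⟨y, hy⟩ * (inl z)⁻¹, ?_, ?_⟩⟩
  · simpa [α] using hyH
  · simp [β]

end ConjugatesModuloKernel

section MinimalInvariantCover

variable {A : Type*} [Group A] {G : Subgroup A} [G.Normal] {g : A}

theorem mk_conjNormal (x : A) (a : G) :
    QuotientGroup.mk' (solubleRadical G) (MulAut.conjNormal x a) =
      conjModRadical G x (QuotientGroup.mk' (solubleRadical G) a) := rfl

theorem exists_conj_notMem_of_minimal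
    (hmin : Minimal (fun K : Subgroup G => IsInvariantUnder G g K ∧ CoversModRadical K) ⊤) {x : A}
    (hgx : Commute x g) (hx : autCommutator (conjModRadical G x) = ⊤) {K : Subgroup A}
    (hK : ¬ G ≤ K) : ∃ z ∈ G, z * x * z⁻¹ ∉ K := by
  by_contra! hconj
  have hinv : IsInvariantUnder G g (autCommutator (MulAut.conjNormal x)) :=
    smul_autCommutator_of_commute (hgx.map MulAut.conjNormal)
  have hcovers : CoversModRadical (autCommutator (MulAut.conjNormal x : MulAut G)) :=
    (map_autCommutator (QuotientGroup.mk'_surjective _) (mk_conjNormal x)).trans hx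
  have htop := hmin.le_of_le ⟨hinv, hcovers⟩ le_top
  have hle : autCommutator (MulAut.conjNormal x : MulAut G) ≤ K.subgroupOf G := by
    refine autCommutator_le.2 fun z => ?_
    have hmem := mul_mem (hconj z z.2) (inv_mem (hconj 1 (one_mem G)))
    simpa [Subgroup.mem_subgroupOf, mul_assoc] using hmem
  exact hK fun a ha => hle (htop (Subgroup.mem_top ⟨a, ha⟩))

theorem exists_conj_mem_imp_eq_one_of_le_sup [Finite A]
    (hmin : Minimal (fun K : Subgroup G => IsInvariantUnder G g K ∧ CoversModRadical K) ⊤)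
    {T : Type*} [Group T] {f : G ⧸ solubleRadical G →* T}
    (hf : IsFaithfulProjection ((conjModRadical G).comp (Subgroup.zpowers g).subtype) f)
    (hT : IsNonabelianSimple T) {H : Subgroup A} (hH : ¬ G ≤ H)
    (hsup : G ≤ H ⊔ (solubleRadical G).map G.subtype) :
    ∃ z ∈ G, ∀ y ∈ Subgroup.zpowers g, z * y * z⁻¹ ∈ H → conjModRadical G y = 1 := by
  obtain ⟨ι, _, q, x, hqinj, hx, hdetect⟩ := exists_isPrimaryModulo_family
    ((conjModRadical G).ker.subgroupOf (Subgroup.zpowers g))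
  have hsol : Group.IsSolvable ((solubleRadical G).map G.subtype) :=
    Group.isSolvable_of_surjective (G.subtype.subgroupMap_surjective (solubleRadical G))
  have hxcomm (i j : ι) : Commute (x i : A) (x j) := congrArg Subtype.val (mul_comm' (x i) (x j))
  have hpow (i : ι) : ∃ k, (x i : A) ^ q i ^ k = 1 :=
    (hx i).exists_pow_eq_one.imp fun k hk => congrArg Subtype.val hk
  have hmove (K : Subgroup A) (hK : ¬ G ≤ K) (i : ι) : ∃ z ∈ G, z * x i * z⁻¹ ∉ K :=
    exists_conj_notMem_of_minimal hmin
      (congrArg Subtype.val (mul_comm' (x i) ⟨g, Subgroup.mem_zpowers g⟩))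
      (hf.autCommutator_eq_top hT (x := x i) (hx i).notMem) hK
  obtain ⟨z, hz, hzx⟩ := exists_forall_conj_notMem_of_le_sup_isSolvable
    (Subgroup.map_subtype_le _) hsup hH hxcomm hqinj (fun i => (hx i).prime) hpow hmove
  refine ⟨z, hz, fun y hy hyH => ?_⟩
  by_contra hyC
  obtain ⟨i, n, hi⟩ := hdetect ⟨y, hy⟩ hyC
  refine hzx i ?_
  rw [← hi, Subgroup.coe_zpow, ← conj_zpow]
  exact zpow_mem hyH n

end MinimalInvariantCover

section CyclicOrbits

theorem orbit_zpowers_map {A B α : Type*} [Group A] [Group B] [MulAction B α] (φ : A →* B) (g : A)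
    (s : α) : MulAction.orbit (Subgroup.zpowers (φ g)) s =
      Set.range fun y : Subgroup.zpowers g => φ y • s := by
  ext t
  simp [MulAction.mem_orbit_iff, Subgroup.exists_zpowers, Subgroup.smul_def]

theorem exists_pow_eq_one_of_isPGroup_stabilizer {B α : Type*} [Group B] [MulAction B α]
    {U : Subgroup B} {s : α} {p : ℕ} (h : IsPGroup p (MulAction.stabilizer U s)) {b : B}
    (hb : b ∈ U) (hs : b • s = s) : ∃ n, b ^ p ^ n = 1 :=
  (h ⟨⟨b, hb⟩, hs⟩).imp fun _ hn => congrArg (fun c : MulAction.stabilizer U s => (c : B)) hn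

end CyclicOrbits

theorem mainTheorem5_general {A : Type*} [Group A] [Finite A] (G : Subgroup A) [G.Normal] (g : A)
    (h1 : Minimal (fun K : Subgroup G => IsInvariantUnder G g K ∧ CoversModRadical K) ⊤)
    {ι : Type*} (S : ι → Subgroup (G ⧸ solubleRadical G)) (hprod : IsInternalDirectProduct S)
    (i₀ : ι) (hsimple : IsNonabelianSimple (S i₀))
    (htrans : MulAction.orbit (Subgroup.zpowers (conjModRadical G g)) (S i₀) = Set.range S)
    (p : ℕ) (hp : p.Prime)
    (h4 : IsPGroup p
      (MulAction.stabilizer (Subgroup.zpowers (conjModRadical G g)) (S i₀)))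
    (H : Subgroup A) (hH : ¬ G ≤ H) :
    ∃ z ∈ G, (MulAut.conj z⁻¹ • H) ⊓ Subgroup.zpowers g ≤ centralizerModRadical G g := by
  suffices hconj : ∃ z ∈ G, ∀ y ∈ Subgroup.zpowers g, z * y * z⁻¹ ∈ H → conjModRadical G y = 1 by
    obtain ⟨z, hz, hzH⟩ := hconj
    refine ⟨z, hz, fun y hy => ⟨hy.2, hzH y hy.2 ?_⟩⟩
    simpa using Subgroup.mem_pointwise_smul_iff_inv_smul_mem.1 hy.1
  let φ := (conjModRadical G).comp (Subgroup.zpowers g).subtype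
  have hrange : Set.range (fun y => φ y • S i₀) = Set.range S :=
    (orbit_zpowers_map (conjModRadical G) g (S i₀)).symm.trans htrans
  have hnormal := hprod.normal i₀
  have hT := hprod.isNonabelianSimple_quotient_centralizer hsimple
  have hfaithful := hprod.isFaithfulProjection (φ := φ) (center_quotient_solubleRadical G)
    (i₀ := i₀) fun i => Set.mem_range.1 (hrange.symm.subset ⟨i, rfl⟩)
  by_cases hsup : G ≤ H ⊔ (solubleRadical G).map G.subtype
  · exact exists_conj_mem_imp_eq_one_of_le_sup h1 hfaithful hT hH hsup
  · have hstab (y) (hy : y ∈ kerStabilizer φ (QuotientGroup.mk'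
        (Subgroup.centralizer (S i₀ : Set (G ⧸ solubleRadical G))))) : ∃ n, φ y ^ p ^ n = 1 :=
      exists_pow_eq_one_of_isPGroup_stabilizer h4
        (MonoidHom.map_zpowers (conjModRadical G) g ▸ Subgroup.mem_map_of_mem _ y.2)
        (hprod.smul_eq_of_mem_kerStabilizer hsimple.not_isMulCommutative hy
          (hrange.subset ⟨y, rfl⟩))
    rw [← QuotientGroup.ker_mk' (solubleRadical G)] at hsup
    exact exists_conj_mem_imp_eq_one_of_not_le_sup (QuotientGroup.mk'_surjective _)
      mk_conjNormal hfaithful hT hp hstab hsup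

theorem mainTheorem5 {A : Type*} [Group A] [Finite A] (G : Subgroup A) [G.Normal] (g : A)
    (hA : G ⊔ Subgroup.zpowers g = ⊤)
    -- `G` is a minimal `g`-invariant subgroup covering `G/R`
    (h1 : Minimal (fun K : Subgroup G => IsInvariantUnder G g K ∧ CoversModRadical K) ⊤)
    -- `G ∩ ⟨g⟩ ≤ C_{⟨g⟩}(G/R)`
    (h2 : G ⊓ Subgroup.zpowers g ≤ centralizerModRadical G g)
    -- `G/R = S_1 × ⋯ × S_r`, isomorphic nonabelian simple factors
    (r : ℕ) (S : Fin r → Subgroup (G ⧸ solubleRadical G))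
    (hprod : IsInternalDirectProduct S)
    (hsimple : ∀ i, IsNonabelianSimple (S i))
    (hiso : ∀ i j, Nonempty (S i ≃* S j))
    -- the set of the factors is a single orbit of `⟨ḡ⟩`; `i₀` is the index of the factor `S_1`
    (i₀ : Fin r)
    (htrans : MulAction.orbit (Subgroup.zpowers (conjModRadical G g)) (S i₀) = Set.range S)
    -- the stabilizer of `S_1` in `⟨ḡ⟩` is a `p`-group
    (p : ℕ) (hp : p.Prime)
    (h4 : IsPGroup p
      (MulAction.stabilizer (Subgroup.zpowers (conjModRadical G g)) (S i₀)))
    (H : Subgroup A) (hH : ¬ G ≤ H) :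
    ∃ z ∈ G, (MulAut.conj z⁻¹ • H) ⊓ Subgroup.zpowers g ≤ centralizerModRadical G g :=
  mainTheorem5_general G g h1 S hprod i₀ (hsimple i₀) htrans p hp h4 H hH
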